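/- Let $n \ge 0$ and $R_n = \mathbb{Q}[x_1,\dots,x_n]$. A noncrossing partition of size $n$ is a set $\lambda$ of arcs $(i,j)$ with $1 \le i < j \le n$ containing no two distinct arcs $(i,k)$, $(j,l)$ with $i \le j < k \le l$; it is regarded as a graph on the vertices $1,\dots,n$. Let $Q_\lambda$ be the permutation of $\{1,\dots,n\}$ with $Q_\lambda(j) = i$ if $(i,j) \in \lambda$ for some $i$, and with $Q_\lambda(j)$ the largest vertex in the connected component of $j$ if there is no such $i$. Let $\mathrm{QSV}_n$ be the set of all permutations $Q_\lambda$. A permutation $\sigma$ is identified with the point $(\sigma(1),\dots,\sigma(n)) \in \mathbb{Q}^n$, and $\mathbf{I}(\mathrm{QSV}_n) \subseteq R_n$ denotes the ideal of all polynomials vanishing on $\mathrm{QSV}_n \subset \mathbb{Q}^n$. For a composition $\alpha = (\alpha_1,\dots,\alpha_k)$ (a finite sequence of positive integers) put $$P_\alpha = \sum_{1 = f_1 < f_2 < \cdots < f_{\ell+1} = k+1}\ \ \sum_{1 \le i_1 < \cdots < i_\ell \le n}\ \ \prod_{j=1}^{\ell}\Big( \big(x_{i_j}^{\alpha_{f_j}}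 - i_j^{\alpha_{f_j}}\big) \prod_{s = f_j+1}^{f_{j+1}-1} \big(-\,i_j^{\alpha_s}\big)\Big) \in R_n,$$ where the first sum is over all $\ell$ and all such sequences $(f_1,\dots,f_{\ell+1})$ (equivalently, over all compositions $\beta$ that $\alpha$ refines, with $\beta_j = \alpha_{f_j} + \cdots + \alpha_{f_{j+1}-1}$). A polynomial $f \in R_n$ is quasisymmetric if for all positive integers $a_1,\dots,a_k$ the coefficient of $x_{i_1}^{a_1}\cdots x_{i_k}^{a_k}$ in $f$ is the same for all $1 \le i_1 < \cdots < i_k \le n$. Let $\mathrm{QSym}_n^+$ be the space of quasisymmetric polynomials with zero constant term. For $f \in R_n$ let $\mathsf{h}(f)$ be its homogeneous component of top degree, and for an ideal $I \subseteq R_n$ let $\mathsf{gr}(I) = \langle \mathsf{h}(f) \mid f \in I\rangle$. Then $$\langle P_\alpha \mid \alpha \text{ a nonempty composition with at most } n \text{ parts}\rangle = \mathbf{I}(\mathrm{QSV}_n) \qquad\text{and}\qquad \langle \mathrm{QSym}_n^+ \rangle = \mathsf{gr}\big(\mathbf{I}(\mathrm{QSV}_n)\big).$$ -/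

import Mathlib

noncomputable section

/-- A noncrossing partition of size `n`, as a diagram of arcs `(i, j)`, `i < j`, on the vertices
`1, …, n` (the vertex `v` is `v - 1 : Fin n`), such that there are no two different arcs
`(i, k)`, `(j, l)` with `i ≤ j < k ≤ l`. -/
structure NoncrossingPartition (n : ℕ) where
  arcs : Finset (Fin n × Fin n)
  lt_of_mem : ∀ p ∈ arcs, p.1 < p.2
  noncrossing : ∀ p ∈ arcs, ∀ q ∈ arcs, p ≠ q → ¬ (p.1 ≤ q.1 ∧ q.1 < p.2 ∧ p.2 ≤ q.2)

namespace NoncrossingPartition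

variable {n : ℕ} (L : NoncrossingPartition n)

/-- The underlying undirected graph of the diagram. -/
def graph : SimpleGraph (Fin n) where
  Adj i j := (i, j) ∈ L.arcs ∨ (j, i) ∈ L.arcs
  symm := ⟨fun _ _ h => h.symm⟩
  loopless := ⟨fun i h => by
    rcases h with h | h <;> exact absurd (L.lt_of_mem _ h) (lt_irrefl i)⟩

open Classical in
/-- The set of vertices connected to `j`. -/
def component (j : Fin n) : Finset (Fin n) :=
  Finset.univ.filter fun k => L.graph.Reachable j k

theorem mem_component {j k : Fin n} : k ∈ L.component j ↔ L.graph.Reachable j k := by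
  simp [component]

theorem self_mem_component (j : Fin n) : j ∈ L.component j := by
  simp [component]

open Classical in
/-- The map `Q_λ`: it sends `j` to its leftward neighbour if `j` is a right endpoint, and to the
largest vertex connected to `j` otherwise. -/
def qFun (j : Fin n) : Fin n :=
  if h : ∃ i, (i, j) ∈ L.arcs then h.choose
  else (L.component j).max' ⟨j, L.self_mem_component j⟩

theorem eq_of_left {i j k : Fin n} (h1 : (i, j) ∈ L.arcs) (h2 : (i, k) ∈ L.arcs) : j = k := by
  by_contra hne
  rcases lt_or_gt_of_ne hne with h | h
  · exact L.noncrossing _ h1 _ h2 (by simpa using hne) ⟨le_rfl, L.lt_of_mem _ h1, h.le⟩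
  · exact L.noncrossing _ h2 _ h1 (by simpa using Ne.symm hne) ⟨le_rfl, L.lt_of_mem _ h2, h.le⟩

theorem eq_of_right {i j k : Fin n} (h1 : (i, k) ∈ L.arcs) (h2 : (j, k) ∈ L.arcs) : i = j := by
  by_contra hne
  rcases lt_or_gt_of_ne hne with h | h
  · exact L.noncrossing _ h1 _ h2 (by simpa using hne) ⟨h.le, L.lt_of_mem _ h2, le_rfl⟩
  · exact L.noncrossing _ h2 _ h1 (by simpa using Ne.symm hne) ⟨h.le, L.lt_of_mem _ h1, le_rfl⟩

theorem qFun_of_mem {i j : Fin n} (h : (i, j) ∈ L.arcs) : L.qFun j = i := by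
  have hex : ∃ i, (i, j) ∈ L.arcs := ⟨i, h⟩
  unfold qFun
  rw [dif_pos hex]
  exact L.eq_of_right hex.choose_spec h

theorem qFun_of_not_mem {j : Fin n} (h : ∀ i, (i, j) ∉ L.arcs) :
    L.graph.Reachable j (L.qFun j) ∧ ∀ k, L.graph.Reachable j k → k ≤ L.qFun j := by
  have hex : ¬ ∃ i, (i, j) ∈ L.arcs := fun ⟨i, hi⟩ => h i hi
  unfold qFun
  rw [dif_neg hex]
  constructor
  · have := (L.component j).max'_mem ⟨j, L.self_mem_component j⟩
    exact L.mem_component.mp this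
  · intro k hk
    exact Finset.le_max' _ _ (L.mem_component.mpr hk)

theorem le_of_reachable {x y : Fin n} (hx : ∀ i, (i, x) ∉ L.arcs)
    (h : L.graph.Reachable x y) : x ≤ y := by
  have key : Relation.ReflTransGen (fun a b => (a, b) ∈ L.arcs) x y := by
    rw [SimpleGraph.reachable_iff_reflTransGen] at h
    induction h with
    | refl => exact .refl
    | tail _ hbc ih =>
      rcases hbc with hbc | hcb
      · exact ih.tail hbc
      · rcases ih.cases_tail with rfl | ⟨d, hd, hdb⟩
        · exact absurd hcb (hx _)
        · rwa [L.eq_of_right hcb hdb]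
  clear h
  induction key with
  | refl => exact le_rfl
  | tail _ hbc ih => exact ih.trans (L.lt_of_mem _ hbc).le

theorem qFun_injective : Function.Injective L.qFun := by
  have mixed : ∀ i j j' : Fin n, (i, j) ∈ L.arcs → (∀ k, (k, j') ∉ L.arcs) →
      L.qFun j = L.qFun j' → False := by
    intro i j j' hi hj' h
    rw [L.qFun_of_mem hi] at h
    obtain ⟨h1, h2⟩ := L.qFun_of_not_mem hj'
    rw [← h] at h1 h2
    have hadj : L.graph.Adj i j := Or.inl hi
    exact absurd (h2 j (h1.trans hadj.reachable)) (not_le.mpr (L.lt_of_mem _ hi))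
  intro j j' h
  by_cases hj : ∃ i, (i, j) ∈ L.arcs <;> by_cases hj' : ∃ i, (i, j') ∈ L.arcs
  · obtain ⟨i, hi⟩ := hj
    obtain ⟨i', hi'⟩ := hj'
    rw [L.qFun_of_mem hi, L.qFun_of_mem hi'] at h
    subst h
    exact L.eq_of_left hi hi'
  · obtain ⟨i, hi⟩ := hj
    exact (mixed i j j' hi (fun k hk => hj' ⟨k, hk⟩) h).elim
  · obtain ⟨i, hi⟩ := hj'
    exact (mixed i j' j hi (fun k hk => hj ⟨k, hk⟩) h.symm).elim
  · have a1 : ∀ k, (k, j) ∉ L.arcs := fun k hk => hj ⟨k, hk⟩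
    have a2 : ∀ k, (k, j') ∉ L.arcs := fun k hk => hj' ⟨k, hk⟩
    have r1 := (L.qFun_of_not_mem a1).1
    have r2 := (L.qFun_of_not_mem a2).1
    rw [← h] at r2
    have r : L.graph.Reachable j j' := r1.trans r2.symm
    exact le_antisymm (L.le_of_reachable a1 r) (L.le_of_reachable a2 r.symm)

/-- The permutation `Q_λ`. -/
def qPerm : Equiv.Perm (Fin n) :=
  Equiv.ofBijective L.qFun (Finite.injective_iff_bijective.mp L.qFun_injective)

end NoncrossingPartition

/-- The set of permutations `QSV_n = {Q_λ}`, `λ` a noncrossing partition of size `n`. -/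
def QSV (n : ℕ) : Set (Equiv.Perm (Fin n)) :=
  Set.range (NoncrossingPartition.qPerm (n := n))

/-- The point `(σ_1, …, σ_n) ∈ ℚⁿ` of a permutation `σ` of `1, …, n`; the entry that `Fin n`
numbers as `v` is the integer `v + 1`. -/
def permPoint {n : ℕ} (σ : Equiv.Perm (Fin n)) : Fin n → ℚ :=
  fun j => ((σ j : ℕ) : ℚ) + 1

/-- `QSV_n` as a set of points of `ℚⁿ`. -/
def QSVPoints (n : ℕ) : Set (Fin n → ℚ) := permPoint '' QSV n

open Classical in
/-- The polynomial
`P_α = ∑_{β ⪰ α} ∑_{i_1 < ⋯ < i_ℓ} ∏_j ((x_{i_j} ^ α_{f_j} - i_j ^ α_{f_j}) ∏_{f_j < s < f_{j+1}} (-(i_j ^ α_s)))`.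
The compositions `β` refined by `α` are the compositions `α.gather c`, one for each way `c` of
cutting the sequence of the parts of `α` into `ℓ = c.length` nonempty consecutive blocks; the
`j`-th block consists of the parts numbered `f_j, …, f_{j+1} - 1`, which are the values of
`c.embedding j`, with `f_j` its value at `0`. -/
def vanishingPoly (n : ℕ) {d : ℕ} (α : Composition d) : MvPolynomial (Fin n) ℚ :=
  ∑ c : Composition α.length,
    ∑ i ∈ Finset.univ.filter (fun i : Fin c.length → Fin n => StrictMono i),
      ∏ j : Fin c.length,
        ((MvPolynomial.X (i j) ^ α.blocksFun (c.embedding j ⟨0, c.one_le_blocksFun j⟩)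
            - MvPolynomial.C
              ((((i j : ℕ) : ℚ) + 1) ^ α.blocksFun (c.embedding j ⟨0, c.one_le_blocksFun j⟩)))
          * ∏ s ∈ Finset.univ.filter (fun s : Fin (c.blocksFun j) => 0 < (s : ℕ)),
              MvPolynomial.C (-((((i j : ℕ) : ℚ) + 1) ^ α.blocksFun (c.embedding j s))))

/-- A polynomial is quasisymmetric if, for all positive exponents `a_1, …, a_k`, the coefficient
of `x_{i_1}^{a_1} ⋯ x_{i_k}^{a_k}` is the same for all `i_1 < ⋯ < i_k`. -/
def IsQuasisymmetric {n : ℕ} (f : MvPolynomial (Fin n) ℚ) : Prop :=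
  ∀ (k : ℕ) (a : Fin k → ℕ), (∀ t, 0 < a t) →
    ∀ i j : Fin k → Fin n, StrictMono i → StrictMono j →
      f.coeff (∑ t, Finsupp.single (i t) (a t)) = f.coeff (∑ t, Finsupp.single (j t) (a t))

/-- The space `QSym_n^+`: quasisymmetric polynomials all of whose terms have positive degree,
i.e. with zero constant term. -/
def QSymPos (n : ℕ) : Set (MvPolynomial (Fin n) ℚ) :=
  {f | IsQuasisymmetric f ∧ MvPolynomial.constantCoeff f = 0}

/-- The top-degree homogeneous component `h(f)`. -/
def topComponent {n : ℕ} (f : MvPolynomial (Fin n) ℚ) : MvPolynomial (Fin n) ℚ :=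
  MvPolynomial.homogeneousComponent f.totalDegree f

/-- The ideal `gr(I)` generated by the top-degree components of the elements of `I`. -/
def topDegreeIdeal {n : ℕ} (I : Ideal (MvPolynomial (Fin n) ℚ)) :
    Ideal (MvPolynomial (Fin n) ℚ) :=
  Ideal.span (topComponent '' (I : Set (MvPolynomial (Fin n) ℚ)))

end

/-! ### The polynomials `P_α` as coefficients of an ordered product of operators -/

noncomputable section

/-! Let `g(x)` be the noncommutative series `1 + ∑ xᵃ yₐ`. Summing over the cuts of `α` into blocks
shows that `P_α` is the coefficient of the word `α` in the ordered product `∏ g(x_v) g(v)⁻¹` over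
the vertices `v` (`vanishingPoly_eq_shiftedQSym`). At a point `Q_λ` this becomes `∏ g(Q_λ(v))
g(v)⁻¹`, which is `1` for every function `g` into a group: contracting a shortest arc of `λ`
preserves the product, and without arcs `Q_λ` is the identity (`prod_qFun`). Hence every `P_α` with
`α` nonempty vanishes on `QSV_n`.

The constants `v` have degree zero, so the top-degree part of `P_α` is the monomial quasisymmetric
polynomial `M_α`, if this is nonzero (`vanishingPoly_sub_mem_degreeLT`). The `M_α` with `α` nonempty
generate the ideal of `QSym_n^+` (`span_QSymPos`).

Both equalities then follow from a dimension squeeze. Modulo the `M_α`, every polynomial is a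
combination of monomials with exponent vectors strictly below the diagonal (`monomial_mem_of_dyck`,
by lexicographic descent with fundamental quasisymmetric functions). Induction on degree transfers
this to the ideal of the `P_α` (`exists_add_dyck_of_mem_degreeLT`). Evaluation therefore maps the
span of these monomials onto the functions on `QSV_n`. The exponent vectors inject into `QSV_n`
(`dyckPoint_injective`), so evaluation is bijective on the span, and no nonzero element of the span
vanishes on `QSV_n` (`eq_zero_of_mem_dyckSpan`). This forces the `P_α` to generate the whole
vanishing ideal and its leading forms to lie in the ideal of the `M_α`. -/

/-- The action of the noncommutative power series `1 + ∑ xᵃ yₐ` on functions of words. -/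
def letterAct {R : Type*} [CommRing R] (x : R) (f : List ℕ → R) : List ℕ → R
  | [] => f []
  | a :: w => f (a :: w) + x ^ a * f w

/-- The inverse of `letterAct c`. -/
def letterInv {R : Type*} [CommRing R] (c : R) (f : List ℕ → R) : List ℕ → R
  | [] => f []
  | a :: w => f (a :: w) - c ^ a * letterInv c f w

/-- The function of words that is `1` at the empty word and `0` elsewhere. -/
def emptyWord {R : Type*} [CommRing R] : List ℕ → R
  | [] => 1
  | _ :: _ => 0

/-- The monomial quasisymmetric function `M_α` of a list of variables, as a function of `α`. -/
def monomialQSym {R : Type*} [CommRing R] : List R → List ℕ → R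
  | [] => emptyWord
  | x :: l => letterAct x (monomialQSym l)

/-- The polynomials `P_α` of a list of pairs of a variable and a constant. -/
def shiftedQSym {R : Type*} [CommRing R] : List (R × R) → List ℕ → R
  | [] => emptyWord
  | p :: l => letterAct p.1 (letterInv p.2 (shiftedQSym l))

section

variable {R : Type*} [CommRing R]

@[simp] theorem letterAct_nil (x : R) (f : List ℕ → R) : letterAct x f [] = f [] := rfl

@[simp] theorem letterAct_cons (x : R) (f : List ℕ → R) (a : ℕ) (w : List ℕ) :
    letterAct x f (a :: w) = f (a :: w) + x ^ a * f w := rfl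

@[simp] theorem letterInv_nil (x : R) (f : List ℕ → R) : letterInv x f [] = f [] := rfl

@[simp] theorem letterInv_cons (x : R) (f : List ℕ → R) (a : ℕ) (w : List ℕ) :
    letterInv x f (a :: w) = f (a :: w) - x ^ a * letterInv x f w := rfl

@[simp] theorem emptyWord_nil : (emptyWord [] : R) = 1 := rfl

@[simp] theorem emptyWord_cons (a : ℕ) (w : List ℕ) : (emptyWord (a :: w) : R) = 0 := rfl

theorem letterInv_letterAct (c : R) (f : List ℕ → R) : letterInv c (letterAct c f) = f := by
  funext w
  induction w with
  | nil => rfl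
  | cons a w ih => simp [ih]

theorem letterAct_letterInv (c : R) (f : List ℕ → R) : letterAct c (letterInv c f) = f := by
  funext w
  cases w <;> simp

@[simp] theorem monomialQSym_nil (l : List R) : monomialQSym l [] = 1 := by
  induction l with
  | nil => rfl
  | cons x l ih => simpa [monomialQSym]

@[simp] theorem monomialQSym_cons (x : R) (l : List R) (a : ℕ) (w : List ℕ) :
    monomialQSym (x :: l) (a :: w) = monomialQSym l (a :: w) + x ^ a * monomialQSym l w := rfl

/-- Sum over increasing choices of indices of products of weights. -/
def increasingSum {β : Type*} {n : ℕ} (ψ : Fin n → β → R) (L : List β) : R :=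
  open Classical in
  ∑ i ∈ Finset.univ.filter (fun i : Fin L.length → Fin n => StrictMono i),
    ∏ j : Fin L.length, ψ (i j) (L.get j)

theorem increasingSum_nil {β : Type*} {n : ℕ} (ψ : Fin n → β → R) :
    increasingSum ψ [] = 1 := by
  classical
  unfold increasingSum
  rw [Finset.filter_true_of_mem]
  · simp
  · intro i _ a
    exact a.elim0

theorem increasingSum_zero {β : Type*} (ψ : Fin 0 → β → R) (u : β) (L : List β) :
    increasingSum ψ (u :: L) = 0 := by
  classical
  unfold increasingSum
  apply Finset.sum_eq_zero
  intro i _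
  exact (i ⟨0, by simp⟩).elim0

theorem Fin.strictMono_cons_zero {k n : ℕ} {i : Fin k → Fin n} :
    StrictMono (Fin.cons 0 (fun t => (i t).succ) : Fin (k + 1) → Fin (n + 1)) ↔ StrictMono i := by
  constructor
  · intro h a b hab
    have := h (Fin.succ_lt_succ_iff.mpr hab)
    simpa using this
  · intro h a b hab
    induction a using Fin.cases with
    | zero =>
      induction b using Fin.cases with
      | zero => exact absurd hab (lt_irrefl _)
      | succ b => simp
    | succ a =>
      induction b using Fin.cases with
      | zero => exact absurd hab (Fin.not_lt_zero _)
      | succ b => simpa using h (Fin.succ_lt_succ_iff.mp hab)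

theorem Fin.exists_succ_of_strictMono {k n : ℕ} {i : Fin k → Fin (n + 1)} (hi : StrictMono i)
    (h : ∀ t, i t ≠ 0) : ∃ i' : Fin k → Fin n, StrictMono i' ∧ i = fun t => (i' t).succ := by
  choose i' hi' using fun t => Fin.exists_succ_eq.mpr (h t)
  refine ⟨i', fun a b hab => ?_, funext fun t => (hi' t).symm⟩
  have := hi hab
  rw [← hi' a, ← hi' b] at this
  exact Fin.succ_lt_succ_iff.mp this

/-- An increasing choice of indices either avoids the vertex `0` or uses it for the first entry of
the list, and in both cases the remaining indices are successors. -/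
theorem increasingSum_succ {β : Type*} {n : ℕ} (ψ : Fin (n + 1) → β → R) (u : β) (L : List β) :
    increasingSum ψ (u :: L) = increasingSum (fun v => ψ v.succ) (u :: L)
      + ψ 0 u * increasingSum (fun v => ψ v.succ) L := by
  classical
  have e : increasingSum ψ (u :: L) = ∑ i ∈ Finset.univ.filter
      (fun i : Fin (L.length + 1) → Fin (n + 1) => StrictMono i),
      ∏ j : Fin (L.length + 1), ψ (i j) ((u :: L).get j) := by
    unfold increasingSum
    apply Finset.sum_congr
    · ext; simp
    · intros; rfl
  rw [e, ← Finset.sum_filter_add_sum_filter_not _ (fun i => i 0 ≠ 0)]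
  congr 1
  · unfold increasingSum
    symm
    refine Finset.sum_bij (fun i _ t => (i t).succ) ?_ ?_ ?_ ?_
    · intro i hi
      simp only [Finset.mem_filter, Finset.mem_univ, true_and] at hi ⊢
      exact ⟨fun a b hab => Fin.succ_lt_succ_iff.mpr (hi hab), Fin.succ_ne_zero _⟩
    · intro i _ i' _ h
      funext t
      exact Fin.succ_injective _ (congrFun h t)
    · intro i hi
      simp only [Finset.mem_filter, Finset.mem_univ, true_and] at hi
      obtain ⟨hi, h0⟩ := hi
      obtain ⟨i', h1, h2⟩ := Fin.exists_succ_of_strictMono hi (fun t ht => h0 (by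
        have := hi.monotone (Fin.zero_le t)
        rw [ht] at this
        exact Fin.le_zero_iff.mp this))
      exact ⟨i', by simpa using h1, h2.symm⟩
    · intro i _
      rfl
  · unfold increasingSum
    rw [Finset.mul_sum]
    symm
    refine Finset.sum_bij (fun i _ => Fin.cons 0 (fun t => (i t).succ)) ?_ ?_ ?_ ?_
    · intro i hi
      simp only [Finset.mem_filter, Finset.mem_univ, true_and] at hi ⊢
      exact ⟨Fin.strictMono_cons_zero.mpr hi, by simp⟩
    · intro i _ i' _ h
      funext t
      have := congrFun h t.succ
      simpa using this
    · intro i hi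
      simp only [Finset.mem_filter, Finset.mem_univ, true_and, not_not] at hi
      obtain ⟨hi, h0⟩ := hi
      obtain ⟨i', h1, h2⟩ := Fin.exists_succ_of_strictMono (i := fun t => i t.succ)
        (fun a b hab => hi (Fin.succ_lt_succ_iff.mpr hab)) (fun t ht => by
          have := hi (Fin.succ_pos t)
          rw [ht] at this
          exact Fin.not_lt_zero _ this)
      refine ⟨i', by simpa using h1, ?_⟩
      funext t
      induction t using Fin.cases with
      | zero => simp [h0]
      | succ t => simpa using (congrFun h2 t).symm
    · intro i _
      rw [Fin.prod_univ_succ]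
      simp

theorem increasingSum_eq_monomialQSym {n : ℕ} (x : Fin n → R) (α : List ℕ) :
    increasingSum (fun v a => x v ^ a) α = monomialQSym (List.ofFn x) α := by
  induction n generalizing α with
  | zero =>
    cases α with
    | nil => simp [increasingSum_nil]
    | cons a α => rw [increasingSum_zero]; simp [monomialQSym]
  | succ n ih =>
    cases α with
    | nil => simp [increasingSum_nil]
    | cons a α =>
      rw [increasingSum_succ, List.ofFn_succ, monomialQSym_cons, ← ih, ← ih]

/-- All ways to cut a list into nonempty consecutive pieces. -/
def splits {β : Type*} : List β → List (List (List β))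
  | [] => [[]]
  | a :: w => (splits w).map ([a] :: ·) ++
      (splits w).flatMap fun L => match L with
        | [] => []
        | u :: L' => [(a :: u) :: L']

theorem mem_splits {β : Type*} {w : List β} {L : List (List β)} :
    L ∈ splits w ↔ L.flatten = w ∧ [] ∉ L := by
  induction w generalizing L with
  | nil =>
    simp only [splits, List.mem_singleton]
    constructor
    · rintro rfl; simp
    · rintro ⟨h, h0⟩
      rcases L with _ | ⟨u, L⟩
      · rfl
      · simp at h h0
        exact absurd h.1 h0.1
  | cons a w ih =>
    simp only [splits, List.mem_append, List.mem_map, List.mem_flatMap]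
    constructor
    · rintro (⟨L', hL', rfl⟩ | ⟨L', hL', h⟩)
      · rw [ih] at hL'
        simp [hL'.1, hL'.2]
      · rw [ih] at hL'
        rcases L' with _ | ⟨u, L'⟩
        · simp at h
        · simp only [List.mem_singleton] at h
          subst h
          simp at hL' ⊢
          exact ⟨hL'.1, hL'.2.2⟩
    · rintro ⟨h, h0⟩
      rcases L with _ | ⟨u, L⟩
      · simp at h
      · rcases u with _ | ⟨b, u⟩
        · simp at h0
        · simp at h h0
          obtain ⟨rfl, h⟩ := h
          rcases u with _ | ⟨c, u⟩
          · left
            exact ⟨L, ih.mpr ⟨by simpa using h, h0⟩, rfl⟩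
          · right
            exact ⟨(c :: u) :: L, ih.mpr ⟨by simpa using h, by simpa using h0⟩, by simp⟩

theorem splits_nodup {β : Type*} (w : List β) : (splits w).Nodup := by
  induction w with
  | nil => simp [splits]
  | cons a w ih =>
    rw [splits, List.nodup_append']
    refine ⟨ih.map (fun L L' h => by simpa using h), ?_, ?_⟩
    · rw [List.nodup_flatMap]
      refine ⟨fun L _ => by rcases L with _ | ⟨u, L⟩ <;> simp, ?_⟩
      refine List.Pairwise.imp ?_ ih
      intro L L' hne
      rcases L with _ | ⟨u, L⟩ <;> rcases L' with _ | ⟨u', L'⟩ <;>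
        simp [Function.onFun] at hne ⊢
      exact fun h h' => hne h.symm h'.symm
    · intro L h1 h2
      simp only [List.mem_map, List.mem_flatMap] at h1 h2
      obtain ⟨L1, -, rfl⟩ := h1
      obtain ⟨L2, h2, h3⟩ := h2
      rcases L2 with _ | ⟨u, L2⟩
      · simp at h3
      · simp at h3
        rw [mem_splits] at h2
        simp [h3.1] at h2

theorem sum_composition_eq_sum_splits {β : Type*} (w : List β) (f : List (List β) → R) :
    ∑ c : Composition w.length, f (w.splitWrtComposition c) = ((splits w).map f).sum := by
  classical
  rw [← List.sum_toFinset f (splits_nodup w)]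
  refine Finset.sum_bij (fun c _ => w.splitWrtComposition c) ?_ ?_ ?_ ?_
  · intro c _
    rw [List.mem_toFinset, mem_splits]
    refine ⟨List.flatten_splitWrtComposition _ _, fun h => ?_⟩
    simpa using List.length_pos_of_mem_splitWrtComposition h
  · intro c _ c' _ h
    ext1
    rw [← List.map_length_splitWrtComposition w c, ← List.map_length_splitWrtComposition w c']
    exact congrArg _ h
  · intro L hL
    rw [List.mem_toFinset, mem_splits] at hL
    obtain ⟨rfl, h0⟩ := hL
    refine ⟨⟨L.map List.length, ?_, by simp [List.length_flatten]⟩, Finset.mem_univ _, ?_⟩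
    · intro i hi
      obtain ⟨u, hu, rfl⟩ := List.mem_map.mp hi
      exact List.length_pos_of_ne_nil (fun h => h0 (h ▸ hu))
    · exact List.splitWrtComposition_flatten _ _ rfl
  · intros; rfl

/-- The weight of a block of parts at the vertex with variable `x` and constant `c`. -/
def blockWeight (x c : R) : List ℕ → R
  | [] => 1
  | a :: u => (x ^ a - c ^ a) * (u.map fun s => -(c ^ s)).prod

theorem sum_flatMap_eq {β : Type*} (l : List β) (f : β → List R) :
    (l.flatMap f).sum = (l.map fun b => (f b).sum).sum := by
  induction l with
  | nil => rfl
  | cons b l ih => simp [ih]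

/-- Unrolled, `letterInv c` sums over all prefixes `u` of the word with weight `∏ (-c^s)`. The empty
prefix gives the first sum, and a nonempty prefix serves as the first block of a cut in the second.
-/
theorem letterInv_sum_splits (c : R) (E : List (List ℕ) → R) (w : List ℕ) :
    letterInv c (fun w => ((splits w).map E).sum) w = ((splits w).map E).sum
      + ((splits w).map fun L => match L with
          | [] => 0
          | u :: L' => (u.map fun s => -(c ^ s)).prod * E L').sum := by
  induction w with
  | nil => simp [splits]
  | cons a w ih =>
    rw [letterInv_cons, ih, sub_eq_add_neg]
    congr 1
    conv_rhs => rw [splits]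
    rw [List.map_append, List.sum_append, List.map_map, List.map_flatMap, sum_flatMap_eq,
      ← neg_mul, mul_add, ← List.sum_map_mul_left, ← List.sum_map_mul_left]
    congr 2
    · apply List.map_congr_left
      intro L _
      simp
    · apply List.map_congr_left
      intro L _
      rcases L with _ | ⟨u, L⟩
      · simp
      · simp [mul_assoc]

theorem sum_splits_blockWeight (x c : R) (E : List (List ℕ) → R) (a : ℕ) (w : List ℕ) :
    ((splits (a :: w)).map fun L => match L with
          | [] => 0
          | u :: L' => blockWeight x c u * E L').sum
      = (x ^ a - c ^ a) * letterInv c (fun w => ((splits w).map E).sum) w := by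
  rw [letterInv_sum_splits, splits, List.map_append, List.sum_append, List.map_map,
    List.map_flatMap, sum_flatMap_eq, mul_add, ← List.sum_map_mul_left, ← List.sum_map_mul_left]
  congr 2
  · apply List.map_congr_left
    intro L _
    simp [blockWeight]
  · apply List.map_congr_left
    intro L _
    rcases L with _ | ⟨u, L⟩
    · simp
    · simp [blockWeight, mul_assoc]

/-- Induction on the vertices: the first vertex is unused or carries the first block. The latter
case has the factor `x^a - c^a`, just as `letterAct x` after `letterInv c` adds `(x^a - c^a)` times
`letterInv c` of the tail. -/
theorem sum_splits_increasingSum {n : ℕ} (x c : Fin n → R) (α : List ℕ) :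
    ((splits α).map (increasingSum fun v => blockWeight (x v) (c v))).sum
      = shiftedQSym (List.ofFn fun v => (x v, c v)) α := by
  induction n generalizing α with
  | zero =>
    cases α with
    | nil => simp [splits, increasingSum_nil, shiftedQSym]
    | cons a α =>
      simp only [List.ofFn_zero, shiftedQSym, emptyWord_cons]
      apply List.sum_eq_zero
      intro r hr
      obtain ⟨L, hL, rfl⟩ := List.mem_map.mp hr
      rcases L with _ | ⟨u, L⟩
      · simp [mem_splits] at hL
      · rw [increasingSum_zero]
  | succ n ih =>
    rw [List.ofFn_succ, shiftedQSym]
    have ih' : (fun w => ((splits w).map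
        (increasingSum fun v : Fin n => blockWeight (x v.succ) (c v.succ))).sum)
        = shiftedQSym (List.ofFn fun v : Fin n => (x v.succ, c v.succ)) :=
      funext fun w => ih _ _ w
    rw [← ih']
    cases α with
    | nil => simp [splits, increasingSum_nil]
    | cons a α =>
      rw [letterAct_cons, letterInv_cons]
      have := sum_splits_blockWeight (x 0) (c 0)
        (increasingSum fun v : Fin n => blockWeight (x v.succ) (c v.succ)) a α
      rw [sub_add_eq_add_sub, add_sub_assoc, ← sub_mul, ← this, ← List.sum_map_add]
      congr 1
      apply List.map_congr_left
      intro L hL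
      rcases L with _ | ⟨u, L⟩
      · simp [mem_splits] at hL
      · rw [increasingSum_succ]

end

open MvPolynomial in
theorem vanishingPoly_eq_shiftedQSym (n : ℕ) {d : ℕ} (α : Composition d) :
    vanishingPoly n α = shiftedQSym
      (List.ofFn fun v : Fin n => ((X v, C (((v : ℕ) : ℚ) + 1)) :
        MvPolynomial (Fin n) ℚ × MvPolynomial (Fin n) ℚ)) α.blocks := by
  classical
  rw [← sum_splits_increasingSum, ← sum_composition_eq_sum_splits]
  unfold vanishingPoly
  apply Finset.sum_congr rfl
  intro c _
  unfold increasingSum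
  have hl : (α.blocks.splitWrtComposition c).length = c.length :=
    List.length_splitWrtComposition _ _
  refine Finset.sum_bij (fun i _ t => i (Fin.cast hl t)) ?_ ?_ ?_ ?_
  · intro i hi
    simp only [Finset.mem_filter, Finset.mem_univ, true_and] at hi ⊢
    exact fun a b hab => hi (by simpa using hab)
  · intro i _ i' _ h
    funext t
    simpa using congrFun h (Fin.cast hl.symm t)
  · intro i hi
    simp only [Finset.mem_filter, Finset.mem_univ, true_and] at hi
    refine ⟨fun t => i (Fin.cast hl.symm t), ?_, by simp⟩
    simp only [Finset.mem_filter, Finset.mem_univ, true_and]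
    exact fun a b hab => hi (by simpa using hab)
  · intro i _
    refine Fintype.prod_equiv (finCongr hl.symm) _ _ fun j => ?_
    have key : (α.blocks.splitWrtComposition c).get (finCongr hl.symm j)
        = List.ofFn fun s : Fin (c.blocksFun j) => α.blocksFun (c.embedding j s) := by
      apply List.ext_get
      · have h1 := List.map_length_splitWrtComposition α.blocks c
        have h2 := congrArg (fun l : List ℕ => l[(j : ℕ)]?) h1
        simp only [List.getElem?_map] at h2
        rw [List.getElem?_eq_getElem (by rw [hl]; exact j.2),
          List.getElem?_eq_getElem (by exact j.2)] at h2
        simpa [Composition.blocksFun] using h2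
      · intro m h1 h2
        have h3 : (α.blocks.splitWrtComposition c).get (finCongr hl.symm j)
            = (α.blocks.take (c.sizeUpTo (j + 1))).drop (c.sizeUpTo j) :=
          List.getElem_splitWrtComposition _ _ _ _
        refine (List.get_of_eq h3 _).trans ?_
        simp [Composition.blocksFun]
        rfl
    simp only [finCongr_apply, Fin.cast_cast, Fin.cast_eq_self] at key ⊢
    rw [key]
    -- The block length is written `k + 1` to split off its first part. It occurs in the type of the
    -- embedding, which is therefore generalized first.
    obtain ⟨k, hk⟩ := Nat.exists_eq_add_of_le' (c.one_le_blocksFun j)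
    generalize hg : c.embedding j = g
    clear hg key
    revert g
    generalize_proofs h0
    revert h0
    rw [hk]
    intro h0 g
    rw [List.ofFn_succ, blockWeight, Finset.prod_filter, Fin.prod_univ_succ, List.map_ofFn,
      List.prod_ofFn]
    simp

end

/-! ### Vanishing of the `P_α` on `QSV_n`: a group identity -/

noncomputable section

/-- `letterAct x` as a permutation. -/
def letterPerm {R : Type*} [CommRing R] (x : R) : Equiv.Perm (List ℕ → R) where
  toFun := letterAct x
  invFun := letterInv x
  left_inv := letterInv_letterAct x
  right_inv := letterAct_letterInv x

theorem shiftedQSym_eq_prod {R : Type*} [CommRing R] (l : List (R × R)) :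
    shiftedQSym l
      = (l.map fun p => letterPerm p.1 * (letterPerm p.2)⁻¹).prod (emptyWord : List ℕ → R) := by
  induction l with
  | nil => rfl
  | cons p l ih =>
    rw [shiftedQSym, ih, List.map_cons, List.prod_cons]
    rfl

theorem map_letterAct {R S : Type*} [CommRing R] [CommRing S] (φ : R →+* S) (x : R)
    (f : List ℕ → R) : (fun w => φ (letterAct x f w)) = letterAct (φ x) (fun w => φ (f w)) := by
  funext w
  cases w <;> simp

theorem map_letterInv {R S : Type*} [CommRing R] [CommRing S] (φ : R →+* S) (x : R)
    (f : List ℕ → R) : (fun w => φ (letterInv x f w)) = letterInv (φ x) (fun w => φ (f w)) := by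
  funext w
  induction w with
  | nil => rfl
  | cons a w ih => simp [ih]

theorem map_shiftedQSym {R S : Type*} [CommRing R] [CommRing S] (φ : R →+* S)
    (l : List (R × R)) :
    (fun w => φ (shiftedQSym l w)) = shiftedQSym (l.map fun p => (φ p.1, φ p.2)) := by
  induction l with
  | nil => funext w; cases w <;> simp [shiftedQSym]
  | cons p l ih => simp only [shiftedQSym, map_letterAct, map_letterInv, ih, List.map_cons]

theorem prod_ofFn_eq_of_merge {G : Type*} [Group G] {n : ℕ} (T T' : Fin n → G) {i j : Fin n}
    (hij : i < j) (hi : T' i = 1) (hj : T' j = T i * T j)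
    (hmid : ∀ m, i < m → m < j → T m = 1) (hother : ∀ m, m ≠ i → m ≠ j → T' m = T m) :
    (List.ofFn T).prod = (List.ofFn T').prod := by
  -- The partial products differ exactly between `i` and `j`, where `T i` is present in one and
  -- still awaited in the other. All factors in between are trivial, so it can be carried along on
  -- the right.
  have key : ∀ k : Fin (n + 1), Fin.partialProd T k = Fin.partialProd T' k *
      (if (i : ℕ) < k ∧ (k : ℕ) ≤ j then T i else 1) := by
    intro k
    induction k using Fin.induction with
    | zero => simp
    | succ k ih =>
      rw [Fin.partialProd_succ, Fin.partialProd_succ, ih]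
      simp only [Fin.val_castSucc, Fin.val_succ]
      have hij' : (i : ℕ) < j := hij
      rcases lt_trichotomy k i with h | rfl | h
      · have h' : (k : ℕ) < i := h
        rw [if_neg (by omega), if_neg (by omega),
          hother k h.ne (h.trans hij).ne]
        simp
      · rw [if_neg (by omega), if_pos (by omega), hi]
      · have h' : (i : ℕ) < k := h
        rcases lt_trichotomy k j with h2 | rfl | h2
        · have h2' : (k : ℕ) < j := h2
          rw [if_pos (by omega), if_pos (by omega), hother k h.ne' h2.ne, hmid k h h2]
          simp
        · rw [if_pos (by omega), if_neg (by omega), hj]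
          simp [mul_assoc]
        · have h2' : (j : ℕ) < k := h2
          rw [if_neg (by omega), if_neg (by omega), hother k h.ne' h2.ne']
          simp
  have h := key (Fin.last n)
  have hj' := j.2
  rw [if_neg (by simp), mul_one] at h
  simp only [Fin.partialProd, Fin.val_last] at h
  rwa [List.take_of_length_le (by simp), List.take_of_length_le (by simp)] at h

/-! ### Contraction of a shortest arc -/

namespace NoncrossingPartition

variable {n : ℕ} (L : NoncrossingPartition n)

/-- There is a path of arcs from left to right. -/
def Path : Fin n → Fin n → Prop := Relation.ReflTransGen fun a b => (a, b) ∈ L.arcs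

/-- Left neighbours are unique, so a leftward step of a walk from `x` retraces the last arc of the
path built so far. At `x` itself no leftward step exists. -/
theorem path_of_reachable {x y : Fin n} (hx : ∀ i, (i, x) ∉ L.arcs)
    (h : L.graph.Reachable x y) : L.Path x y := by
  rw [SimpleGraph.reachable_iff_reflTransGen] at h
  induction h with
  | refl => exact .refl
  | tail _ hbc ih =>
    rcases hbc with hbc | hcb
    · exact ih.tail hbc
    · rcases ih.cases_tail with rfl | ⟨d, hd, hdb⟩
      · exact absurd hcb (hx _)
      · rwa [L.eq_of_right hcb hdb]

theorem not_mem_qFun {v : Fin n} (hv : ∀ i, (i, v) ∉ L.arcs) (k : Fin n) :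
    (L.qFun v, k) ∉ L.arcs := by
  intro h
  obtain ⟨h1, h2⟩ := L.qFun_of_not_mem hv
  have hadj : L.graph.Adj (L.qFun v) k := Or.inl h
  exact absurd (h2 k (h1.trans hadj.reachable)) (not_le.mpr (L.lt_of_mem _ h))

theorem path_qFun {v : Fin n} (hv : ∀ i, (i, v) ∉ L.arcs) : L.Path v (L.qFun v) :=
  L.path_of_reachable hv (L.qFun_of_not_mem hv).1

/-- Right neighbours are unique, so any two paths from `v` are comparable and those that cannot be
extended end at the same vertex. -/
theorem qFun_eq_of_path {v y : Fin n} (hv : ∀ i, (i, v) ∉ L.arcs) (h : L.Path v y)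
    (hy : ∀ k, (y, k) ∉ L.arcs) : L.qFun v = y := by
  have hU : Relator.RightUnique fun a b => (a, b) ∈ L.arcs := fun a b c h1 h2 =>
    L.eq_of_left h1 h2
  rcases Relation.ReflTransGen.total_of_right_unique hU h (L.path_qFun hv) with h' | h'
  · rcases h'.cases_head with h' | ⟨c, hc, -⟩
    · exact h'.symm
    · exact absurd hc (hy c)
  · rcases h'.cases_head with h' | ⟨c, hc, -⟩
    · exact h'
    · exact absurd hc (L.not_mem_qFun hv c)

/-- The arc obtained by moving a right endpoint `i` to `j`. -/
def moveRight (i j : Fin n) (p : Fin n × Fin n) : Fin n × Fin n := if p.2 = i then (p.1, j) else p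

/-- For an arc `(i, j)` with no other arcs strictly below it, remove the vertex `i` from its
block. -/
def contract (i j : Fin n) (hij : (i, j) ∈ L.arcs)
    (hl : ∀ m, i < m → m < j → ∀ r, (r, m) ∉ L.arcs)
    (hr : ∀ m, i < m → m < j → ∀ r, (m, r) ∉ L.arcs) : NoncrossingPartition n where
  arcs := (L.arcs.erase (i, j)).image (moveRight i j)
  lt_of_mem := by
    intro p hp
    obtain ⟨q, hq, rfl⟩ := Finset.mem_image.mp hp
    have hq' := L.lt_of_mem _ (Finset.mem_of_mem_erase hq)
    unfold moveRight
    split_ifs with h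
    · exact (h ▸ hq').trans (L.lt_of_mem _ hij)
    · exact hq'
  noncrossing := by
    intro p hpI q hqI hne
    obtain ⟨⟨a, b⟩, hp', rfl⟩ := Finset.mem_image.mp hpI
    obtain ⟨⟨c, d⟩, hq', rfl⟩ := Finset.mem_image.mp hqI
    obtain ⟨hp0, hp⟩ := Finset.mem_erase.mp hp'
    obtain ⟨hq0, hq⟩ := Finset.mem_erase.mp hq'
    have hne' : ((a, b) : Fin n × Fin n) ≠ (c, d) := fun h => hne (by rw [h])
    have h1 := L.noncrossing _ hp _ hq hne'
    have lt := L.lt_of_mem _ hij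
    have lp := L.lt_of_mem _ hp
    have lq := L.lt_of_mem _ hq
    unfold moveRight at hne ⊢
    simp only at h1 lt lp lq
    -- Two moved arcs would both have ended at `i`, hence coincide. If just one is moved, a
    -- violation either existed before or involves the erased arc or an endpoint strictly between
    -- `i` and `j`.
    split_ifs with hb hd hd
    · exact fun h => hne (by
        simp only at hb hd
        subst hb
        subst hd
        exact absurd (L.eq_of_right hp hq) (fun h' => hne' (by rw [h'])))
    · simp only at hb hd ⊢
      subst hb
      rintro ⟨h2, h3, h4⟩
      rcases lt_trichotomy c b with h | rfl | h
      · exact h1 ⟨h2, h, lt.le.trans h4⟩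
      · exact hq0 (by rw [L.eq_of_left hq hij])
      · exact hr c h h3 d hq
    · simp only at hb hd ⊢
      subst hd
      rintro ⟨h2, h3, h4⟩
      rcases lt_trichotomy b d with h | rfl | h
      · exact h1 ⟨h2, h3, h.le⟩
      · exact hb rfl
      · rcases h4.lt_or_eq with h5 | rfl
        · exact hl b h h5 a hp
        · exact hp0 (by rw [L.eq_of_right hp hij])
    · exact h1

section contract

variable (i j : Fin n) (hij : (i, j) ∈ L.arcs)
  (hl : ∀ m, i < m → m < j → ∀ r, (r, m) ∉ L.arcs)
  (hr : ∀ m, i < m → m < j → ∀ r, (m, r) ∉ L.arcs)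

theorem mem_contract {a b : Fin n} : (a, b) ∈ (L.contract i j hij hl hr).arcs ↔
    ((a, b) ∈ L.arcs ∧ a ≠ i ∧ b ≠ i) ∨ (b = j ∧ (a, i) ∈ L.arcs) := by
  simp only [contract, Finset.mem_image, Finset.mem_erase, Prod.exists]
  constructor
  · rintro ⟨c, d, ⟨h1, h2⟩, h3⟩
    unfold moveRight at h3
    split_ifs at h3 with h
    · simp only [Prod.mk.injEq] at h h3
      obtain ⟨rfl, rfl⟩ := h3
      exact Or.inr ⟨rfl, h ▸ h2⟩
    · simp only [Prod.mk.injEq] at h h3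
      obtain ⟨rfl, rfl⟩ := h3
      refine Or.inl ⟨h2, ?_, h⟩
      rintro rfl
      exact h1 (by rw [L.eq_of_left h2 hij])
  · rintro (⟨h1, h2, h3⟩ | ⟨rfl, h⟩)
    · exact ⟨a, b, ⟨fun h => h2 (congrArg Prod.fst h), h1⟩, by simp [moveRight, h3]⟩
    · refine ⟨a, i, ⟨fun h' => ?_, h⟩, by simp [moveRight]⟩
      exact (L.lt_of_mem _ h).ne (congrArg Prod.fst h')

theorem card_contract_lt : (L.contract i j hij hl hr).arcs.card < L.arcs.card :=
  Finset.card_image_le.trans_lt (Finset.card_erase_lt_of_mem hij)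

theorem path_contract {x y : Fin n} (h : L.Path x y) :
    (L.contract i j hij hl hr).Path (if x = i then j else x) (if y = i then j else y) := by
  induction h with
  | refl => exact .refl
  | @tail b c _ hbc ih =>
    refine ih.trans ?_
    by_cases hb : b = i
    · subst hb
      have := L.eq_of_left hbc hij
      subst this
      simp only [if_true]
      rw [if_neg (L.lt_of_mem _ hij).ne']
    · rw [if_neg hb]
      refine .single ?_
      rw [mem_contract]
      by_cases hc : c = i
      · rw [if_pos hc]
        exact Or.inr ⟨rfl, hc ▸ hbc⟩
      · rw [if_neg hc]
        exact Or.inl ⟨hbc, hb, hc⟩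

theorem qFun_contract_left : (L.contract i j hij hl hr).qFun i = i := by
  have lt := L.lt_of_mem _ hij
  apply qFun_eq_of_path
  · intro k hk
    rw [mem_contract] at hk
    rcases hk with ⟨-, -, h⟩ | ⟨h, -⟩
    · exact h rfl
    · exact lt.ne h
  · exact .refl
  · intro k hk
    rw [mem_contract] at hk
    rcases hk with ⟨-, h, -⟩ | ⟨-, h⟩
    · exact h rfl
    · exact absurd (L.lt_of_mem _ h) (lt_irrefl _)

/-- After contraction `j` takes over the value at `i`, and vertices other than `i`, `j` keep theirs.
A last vertex of a block is never `i`, since `i` has the right neighbour `j`. -/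
theorem qFun_contract {v : Fin n} (hv : v ≠ j) :
    (L.contract i j hij hl hr).qFun (if v = i then j else v) = L.qFun v := by
  by_cases h : ∃ u, (u, v) ∈ L.arcs
  · obtain ⟨u, hu⟩ := h
    rw [L.qFun_of_mem hu]
    apply qFun_of_mem
    rw [mem_contract]
    by_cases hvi : v = i
    · rw [if_pos hvi]
      exact Or.inr ⟨rfl, hvi ▸ hu⟩
    · rw [if_neg hvi]
      refine Or.inl ⟨hu, ?_, hvi⟩
      rintro rfl
      exact hv (L.eq_of_left hu hij)
  · push Not at h
    have hend := L.not_mem_qFun h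
    have hne : L.qFun v ≠ i := fun h' => hend j (h' ▸ hij)
    apply qFun_eq_of_path
    · intro k hk
      rw [mem_contract] at hk
      by_cases hvi : v = i
      · subst hvi
        rw [if_pos rfl] at hk
        rcases hk with ⟨h1, h2, -⟩ | ⟨-, h1⟩
        · exact h2 (L.eq_of_right h1 hij)
        · exact h _ h1
      · rw [if_neg hvi] at hk
        rcases hk with ⟨h1, -, -⟩ | ⟨h1, -⟩
        · exact h _ h1
        · exact hv h1
    · have := L.path_contract i j hij hl hr (L.path_qFun h)
      rwa [if_neg hne] at this
    · intro k hk
      rw [mem_contract] at hk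
      rcases hk with ⟨h1, -, -⟩ | ⟨-, h1⟩ <;> exact hend _ h1

end contract

/-- For an arc of minimal length, another arc with an endpoint strictly inside would be shorter or
would violate the noncrossing condition. -/
theorem exists_shortest_arc (h : L.arcs.Nonempty) : ∃ i j, (i, j) ∈ L.arcs ∧
    (∀ m, i < m → m < j → ∀ r, (r, m) ∉ L.arcs) ∧ ∀ m, i < m → m < j → ∀ r, (m, r) ∉ L.arcs := by
  obtain ⟨⟨i, j⟩, hij, hmin⟩ := Finset.exists_min_image L.arcs (fun p => (p.2 : ℕ) - p.1) h
  refine ⟨i, j, hij, fun m h1 h2 r hr => ?_, fun m h1 h2 r hr => ?_⟩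
  · have h3 := hmin _ hr
    have h4 := L.lt_of_mem _ hr
    rcases le_or_gt r i with h5 | h5
    · exact L.noncrossing _ hr _ hij (fun h => h2.ne (congrArg Prod.snd h)) ⟨h5, h1, h2.le⟩
    · simp only [Fin.lt_def] at *
      omega
  · have h3 := hmin _ hr
    have h4 := L.lt_of_mem _ hr
    rcases le_or_gt r j with h5 | h5
    · simp only [Fin.lt_def, Fin.le_def] at *
      omega
    · exact L.noncrossing _ hij _ hr (fun h => h1.ne (congrArg Prod.fst h)) ⟨h1.le, h2, h5.le⟩

/-- For a shortest arc `(i, j)` one has `Q(j) = i`, so the factors at `i` and `j` telescope to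
`g(Q(i)) g(j)⁻¹`, the factor at `j` after contraction. Vertices strictly between are fixed and
contribute `1`. -/
theorem prod_qFun {G : Type*} [Group G] (g : Fin n → G) :
    (List.ofFn fun v => g (L.qFun v) * (g v)⁻¹).prod = 1 := by
  induction hk : L.arcs.card using Nat.strong_induction_on generalizing L with
  | _ k ih =>
    rcases L.arcs.eq_empty_or_nonempty with h | h
    · have : ∀ v, L.qFun v = v := fun v =>
        L.qFun_eq_of_path (by simp [h]) .refl (by simp [h])
      simp [this]
    · obtain ⟨i, j, hij, hl, hr⟩ := L.exists_shortest_arc h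
      rw [← ih _ (hk ▸ L.card_contract_lt i j hij hl hr) _ rfl]
      have lt := L.lt_of_mem _ hij
      have hQ := fun v hv => L.qFun_contract i j hij hl hr (v := v) hv
      refine prod_ofFn_eq_of_merge _ _ lt ?_ ?_ ?_ ?_
      · simp [qFun_contract_left]
      · have := hQ i lt.ne
        rw [if_pos rfl] at this
        rw [this, L.qFun_of_mem hij]
        group
      · intro m h1 h2
        rw [L.qFun_eq_of_path (hl m h1 h2) .refl (hr m h1 h2), mul_inv_cancel]
      · intro m h1 h2
        have := hQ m h2
        rw [if_neg h1] at this
        rw [this]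

end NoncrossingPartition

open MvPolynomial in
theorem vanishingPoly_mem_vanishingIdeal (n : ℕ) {d : ℕ} (α : Composition d) (hd : 0 < d) :
    vanishingPoly n α ∈ vanishingIdeal ℚ (QSVPoints n) := by
  rw [mem_vanishingIdeal_iff]
  rintro _ ⟨_, ⟨L, rfl⟩, rfl⟩
  rw [vanishingPoly_eq_shiftedQSym]
  have h := congrFun (map_shiftedQSym
    (aeval (permPoint L.qPerm) : MvPolynomial (Fin n) ℚ →ₐ[ℚ] ℚ).toRingHom
    (List.ofFn fun v : Fin n => ((X v, C (((v : ℕ) : ℚ) + 1)) :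
        MvPolynomial (Fin n) ℚ × MvPolynomial (Fin n) ℚ))) α.blocks
  refine h.trans ?_
  rw [shiftedQSym_eq_prod, List.map_map, List.map_ofFn]
  -- The product of operators is the identity, leaving `emptyWord`, which is zero on the nonempty
  -- word `α`.
  have h2 := L.prod_qFun fun v => letterPerm (((v : ℕ) : ℚ) + 1)
  have h3 : α.blocks ≠ [] := fun h => by
    rw [α.blocks_eq_nil] at h
    omega
  have h4 : (emptyWord α.blocks : ℚ) = 0 := by
    obtain ⟨a, w, h⟩ := List.exists_cons_of_ne_nil h3
    rw [h, emptyWord_cons]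
  rw [← h4]
  refine Eq.trans ?_ (congrFun (congrArg (fun e : Equiv.Perm (List ℕ → ℚ) => e emptyWord) h2)
    α.blocks)
  refine congrArg (fun f : Fin n → Equiv.Perm (List ℕ → ℚ) =>
    (List.ofFn f).prod emptyWord α.blocks) (funext fun v => ?_)
  simp [permPoint, NoncrossingPartition.qPerm]

end

/-! ### Degree filtration and the leading form `M_α` of `P_α` -/

noncomputable section

open MvPolynomial

/-- The polynomials of degree less than `d`. -/
def degreeLT (n d : ℕ) : Submodule ℚ (MvPolynomial (Fin n) ℚ) :=
  restrictSupport ℚ {m | m.degree < d}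

theorem mem_degreeLT {n d : ℕ} {p : MvPolynomial (Fin n) ℚ} :
    p ∈ degreeLT n d ↔ ∀ m ∈ p.support, m.degree < d := by
  rw [degreeLT, mem_restrictSupport_iff]
  exact Iff.rfl

theorem degreeLT_mono {n d e : ℕ} (h : d ≤ e) : degreeLT n d ≤ degreeLT n e :=
  restrictSupport_mono _ fun _ hm => lt_of_lt_of_le hm h

/-- The asymmetric bounds, at most `d` and less than `e`, add up without truncated subtraction. The
case `d = 0` covers constants. -/
theorem mul_mem_degreeLT {n d e : ℕ} {p q : MvPolynomial (Fin n) ℚ} (hp : p ∈ degreeLT n (d + 1))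
    (hq : q ∈ degreeLT n e) : p * q ∈ degreeLT n (d + e) := by
  classical
  rw [mem_degreeLT] at *
  intro m hm
  obtain ⟨a, ha, b, hb, rfl⟩ := Finset.mem_add.mp (support_mul p q hm)
  have h1 := hp a ha
  have h2 := hq b hb
  rw [map_add]
  omega

theorem isHomogeneous_mem_degreeLT {n d : ℕ} {p : MvPolynomial (Fin n) ℚ}
    (hp : p.IsHomogeneous d) : p ∈ degreeLT n (d + 1) := by
  rw [mem_degreeLT]
  intro m hm
  have := hp (mem_support_iff.mp hm)
  have h2 : m.degree = d := by
    rw [Finsupp.degree_eq_weight_one]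
    exact this
  rw [h2]
  exact Nat.lt_succ_self d

theorem pow_mem_degreeLT {n : ℕ} {p : MvPolynomial (Fin n) ℚ} (hp : p ∈ degreeLT n 2) (a : ℕ) :
    p ^ a ∈ degreeLT n (a + 1) := by
  induction a with
  | zero => simpa using isHomogeneous_mem_degreeLT (isHomogeneous_one (Fin n) ℚ)
  | succ a ih =>
    rw [pow_succ']
    have := mul_mem_degreeLT (d := 1) hp ih
    rwa [add_comm 1] at this

theorem pow_const_mem_degreeLT {n : ℕ} {p : MvPolynomial (Fin n) ℚ} (hp : p ∈ degreeLT n 1)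
    (a : ℕ) : p ^ a ∈ degreeLT n 1 := by
  induction a with
  | zero => simpa using isHomogeneous_mem_degreeLT (isHomogeneous_one (Fin n) ℚ)
  | succ a ih =>
    rw [pow_succ']
    simpa using mul_mem_degreeLT (d := 0) hp ih

/-- Each correction replaces a positive letter `a` by the constant `c^a`, which loses at least one
degree. -/
theorem letterInv_sub_mem_degreeLT {n : ℕ} {c : MvPolynomial (Fin n) ℚ} (hc : c ∈ degreeLT n 1)
    {f : List ℕ → MvPolynomial (Fin n) ℚ}
    (hf : ∀ w : List ℕ, (∀ a ∈ w, 0 < a) → f w ∈ degreeLT n (w.sum + 1))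
    (w : List ℕ) (hw : ∀ a ∈ w, 0 < a) : letterInv c f w - f w ∈ degreeLT n w.sum := by
  induction w with
  | nil => simp
  | cons a w ih =>
    rw [List.forall_mem_cons] at hw
    rw [letterInv_cons, sub_sub_cancel_left, List.sum_cons]
    refine neg_mem ?_
    have h1 : letterInv c f w ∈ degreeLT n (w.sum + 1) := by
      have := add_mem (degreeLT_mono (Nat.le_succ _) (ih hw.2)) (hf w hw.2)
      rwa [sub_add_cancel] at this
    have h2 := mul_mem_degreeLT (d := 0) (pow_const_mem_degreeLT hc a) h1
    exact degreeLT_mono (by omega) h2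

theorem monomialQSym_isHomogeneous {n : ℕ} (l : List (MvPolynomial (Fin n) ℚ))
    (hl : ∀ x ∈ l, x.IsHomogeneous 1) (w : List ℕ) : (monomialQSym l w).IsHomogeneous w.sum := by
  induction l generalizing w with
  | nil =>
    cases w with
    | nil => simpa [monomialQSym] using isHomogeneous_one (Fin n) ℚ
    | cons a w => simpa [monomialQSym] using isHomogeneous_zero (Fin n) ℚ _
  | cons x l ih =>
    rw [List.forall_mem_cons] at hl
    cases w with
    | nil => simpa using isHomogeneous_one (Fin n) ℚ
    | cons a w =>
      rw [monomialQSym_cons]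
      refine (ih hl.2 _).add ?_
      have := (hl.1.pow a).mul (ih hl.2 w)
      rwa [one_mul] at this

theorem shiftedQSym_sub_monomialQSym {n : ℕ}
    (l : List (MvPolynomial (Fin n) ℚ × MvPolynomial (Fin n) ℚ))
    (hl : ∀ p ∈ l, p.1.IsHomogeneous 1 ∧ p.2.IsHomogeneous 0) (w : List ℕ)
    (hw : ∀ a ∈ w, 0 < a) :
    shiftedQSym l w - monomialQSym (l.map Prod.fst) w ∈ degreeLT n w.sum := by
  induction l generalizing w with
  | nil => simp [shiftedQSym, monomialQSym]
  | cons p l ih =>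
    rw [List.forall_mem_cons] at hl
    obtain ⟨⟨hp1, hp2⟩, hl⟩ := hl
    have hM : ∀ w, monomialQSym (l.map Prod.fst) w ∈ degreeLT n (w.sum + 1) := fun w =>
      isHomogeneous_mem_degreeLT (monomialQSym_isHomogeneous _ (by
        intro x hx
        obtain ⟨q, hq, rfl⟩ := List.mem_map.mp hx
        exact (hl q hq).1) w)
    have hS : ∀ w : List ℕ, (∀ a ∈ w, 0 < a) → shiftedQSym l w ∈ degreeLT n (w.sum + 1) := by
      intro w hw
      have := add_mem (degreeLT_mono (Nat.le_succ _) (ih hl w hw)) (hM w)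
      rwa [sub_add_cancel] at this
    have hB := letterInv_sub_mem_degreeLT (isHomogeneous_mem_degreeLT hp2) hS
    cases w with
    | nil => simp [shiftedQSym, (by simpa using ih hl [] (by simp) :
        shiftedQSym l [] - 1 ∈ degreeLT n 0)]
    | cons a w =>
      have hw' := List.forall_mem_cons.mp hw
      have h1 : letterInv p.2 (shiftedQSym l) w ∈ degreeLT n (w.sum + 1) := by
        have := add_mem (degreeLT_mono (Nat.le_succ _) (hB w hw'.2)) (hS w hw'.2)
        rwa [sub_add_cancel] at this
      have h2 := mul_mem_degreeLT (d := 0)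
        (pow_const_mem_degreeLT (isHomogeneous_mem_degreeLT hp2) a) h1
      have h3 := mul_mem_degreeLT (d := a)
        (pow_mem_degreeLT (isHomogeneous_mem_degreeLT hp1) a) (hB w hw'.2)
      have h4 := mul_mem_degreeLT (d := a)
        (pow_mem_degreeLT (isHomogeneous_mem_degreeLT hp1) a) (ih hl w hw'.2)
      have h5 := ih hl (a :: w) hw
      rw [shiftedQSym, letterAct_cons, letterInv_cons, List.map_cons, monomialQSym_cons,
        List.sum_cons]
      rw [List.sum_cons] at h5
      -- With `S` the shifted and `M` the monomial function of the tail, and `J` the `letterInv` of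
      -- `S`, the difference is `(S - M)(a :: w) + x^a (J - S)(w) + x^a (S - M)(w) - c^a J(w)`.
      have := add_mem (add_mem h5 (add_mem h3 h4))
        (neg_mem (degreeLT_mono (by omega : 0 + (w.sum + 1) ≤ a + w.sum) h2))
      convert this using 1
      ring

/-- The monomial quasisymmetric polynomial `M_α(x_1, …, x_n)`. -/
def monomialQSymPoly (n : ℕ) (α : List ℕ) : MvPolynomial (Fin n) ℚ :=
  monomialQSym (List.ofFn X) α

theorem monomialQSymPoly_isHomogeneous (n : ℕ) (α : List ℕ) :
    (monomialQSymPoly n α).IsHomogeneous α.sum :=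
  monomialQSym_isHomogeneous _ (by
    intro x hx
    obtain ⟨v, rfl⟩ := List.mem_ofFn.mp hx
    exact isHomogeneous_X _ _) _

theorem vanishingPoly_sub_mem_degreeLT (n : ℕ) {d : ℕ} (α : Composition d) :
    vanishingPoly n α - monomialQSymPoly n α.blocks ∈ degreeLT n d := by
  rw [vanishingPoly_eq_shiftedQSym]
  have := shiftedQSym_sub_monomialQSym (List.ofFn fun v : Fin n =>
    ((X v, C (((v : ℕ) : ℚ) + 1)) : MvPolynomial (Fin n) ℚ × MvPolynomial (Fin n) ℚ)) (by
      intro p hp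
      obtain ⟨v, rfl⟩ := List.mem_ofFn.mp hp
      exact ⟨isHomogeneous_X _ _, isHomogeneous_C _ _⟩) α.blocks (fun a ha => α.blocks_pos ha)
  rw [α.blocks_sum, List.map_ofFn] at this
  exact this

theorem monomialQSym_eq_zero {R : Type*} [CommRing R] (l : List R) (α : List ℕ)
    (h : l.length < α.length) : monomialQSym l α = 0 := by
  induction l generalizing α with
  | nil =>
    cases α with
    | nil => simp at h
    | cons a α => rfl
  | cons x l ih =>
    cases α with
    | nil => simp at h
    | cons a α =>
      simp only [List.length_cons] at h
      rw [monomialQSym_cons, ih _ (by simp; omega), ih _ (by omega), mul_zero, add_zero]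

/-! ### The ideal of quasisymmetric polynomials is generated by the `M_α` -/

/-- The exponent vector with entries `a t` at the places `i t`. -/
def placeExponents {n k : ℕ} (i : Fin k → Fin n) (a : Fin k → ℕ) : Fin n →₀ ℕ :=
  ∑ t, Finsupp.single (i t) (a t)

theorem placeExponents_apply {n k : ℕ} {i : Fin k → Fin n} (hi : StrictMono i) (a : Fin k → ℕ)
    (t : Fin k) : placeExponents i a (i t) = a t := by
  classical
  simp only [placeExponents, Finsupp.finsetSum_apply, Finsupp.single_apply, hi.injective.eq_iff]
  simp

theorem placeExponents_eq_zero {n k : ℕ} {i : Fin k → Fin n} (a : Fin k → ℕ) {v : Fin n}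
    (hv : v ∉ Set.range i) : placeExponents i a v = 0 := by
  classical
  simp only [placeExponents, Finsupp.finsetSum_apply, Finsupp.single_apply]
  exact Finset.sum_eq_zero fun t _ => if_neg fun h => hv ⟨t, h⟩

theorem range_eq_of_placeExponents_eq {n k k' : ℕ} {i : Fin k → Fin n} {i' : Fin k' → Fin n}
    {a : Fin k → ℕ} {a' : Fin k' → ℕ} (hi : StrictMono i) (hi' : StrictMono i')
    (ha : ∀ t, 0 < a t) (ha' : ∀ t, 0 < a' t) (h : placeExponents i a = placeExponents i' a') :
    Set.range i = Set.range i' := by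
  ext v
  constructor
  · rintro ⟨t, rfl⟩
    by_contra hv
    have := ha t
    rw [← placeExponents_apply hi a t, h, placeExponents_eq_zero _ hv] at this
    exact lt_irrefl _ this
  · rintro ⟨t, rfl⟩
    by_contra hv
    have := ha' t
    rw [← placeExponents_apply hi' a' t, ← h, placeExponents_eq_zero _ hv] at this
    exact lt_irrefl _ this

theorem length_eq_of_placeExponents_eq {n k k' : ℕ} {i : Fin k → Fin n} {i' : Fin k' → Fin n}
    {a : Fin k → ℕ} {a' : Fin k' → ℕ} (hi : StrictMono i) (hi' : StrictMono i')
    (ha : ∀ t, 0 < a t) (ha' : ∀ t, 0 < a' t) (h : placeExponents i a = placeExponents i' a') :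
    k = k' := by
  have := congrArg Set.ncard (range_eq_of_placeExponents_eq hi hi' ha ha' h)
  rw [← Set.image_univ, ← Set.image_univ, Set.ncard_image_of_injective _ hi.injective,
    Set.ncard_image_of_injective _ hi'.injective] at this
  simpa using this

theorem placeExponents_inj {n k : ℕ} {i i' : Fin k → Fin n} {a a' : Fin k → ℕ}
    (hi : StrictMono i) (hi' : StrictMono i')
    (ha : ∀ t, 0 < a t) (ha' : ∀ t, 0 < a' t) (h : placeExponents i a = placeExponents i' a') :
    i = i' ∧ a = a' := by
  have h1 : i = i' := (hi.range_inj hi').mp (range_eq_of_placeExponents_eq hi hi' ha ha' h)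
  subst h1
  refine ⟨rfl, funext fun t => ?_⟩
  rw [← placeExponents_apply hi a t, h, placeExponents_apply hi]

theorem monomialQSymPoly_eq_sum (n : ℕ) (α : List ℕ) :
    monomialQSymPoly n α = open Classical in ∑ i ∈ Finset.univ.filter
      (fun i : Fin α.length → Fin n => StrictMono i), monomial (placeExponents i α.get) 1 := by
  classical
  rw [monomialQSymPoly, ← increasingSum_eq_monomialQSym, increasingSum]
  apply Finset.sum_congr rfl
  intro i _
  rw [placeExponents, monomial_sum_one]
  exact Finset.prod_congr rfl fun t _ => X_pow_eq_monomial

theorem coeff_monomialQSymPoly (n : ℕ) {α : List ℕ} (hα : ∀ a ∈ α, 0 < a)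
    {i : Fin α.length → Fin n} (hi : StrictMono i) :
    coeff (placeExponents i α.get) (monomialQSymPoly n α) = 1 := by
  classical
  have hpos : ∀ t, 0 < α.get t := fun t => hα _ (List.get_mem _ _)
  rw [monomialQSymPoly_eq_sum, coeff_sum]
  rw [Finset.sum_eq_single i]
  · simp
  · intro i' hi' hne
    rw [coeff_monomial, if_neg]
    intro h
    exact hne (placeExponents_inj (Finset.mem_filter.mp hi').2 hi hpos hpos h).1
  · intro h
    exact absurd (Finset.mem_filter.mpr ⟨Finset.mem_univ _, hi⟩) h

theorem exists_of_coeff_monomialQSymPoly_ne_zero {n : ℕ} {α : List ℕ} {m : Fin n →₀ ℕ}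
    (h : coeff m (monomialQSymPoly n α) ≠ 0) :
    ∃ i : Fin α.length → Fin n, StrictMono i ∧ m = placeExponents i α.get := by
  classical
  by_contra hcon
  push Not at hcon
  apply h
  rw [monomialQSymPoly_eq_sum, coeff_sum]
  apply Finset.sum_eq_zero
  intro i hi
  rw [coeff_monomial, if_neg]
  exact fun h' => hcon i (Finset.mem_filter.mp hi).2 h'.symm

theorem isQuasisymmetric_monomialQSymPoly (n : ℕ) {α : List ℕ} (hα : ∀ a ∈ α, 0 < a) :
    IsQuasisymmetric (monomialQSymPoly n α) := by
  have hpos : ∀ t, 0 < α.get t := fun t => hα _ (List.get_mem _ _)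
  have key : ∀ (k : ℕ) (a : Fin k → ℕ), (∀ t, 0 < a t) → ∀ i j : Fin k → Fin n, StrictMono i →
      StrictMono j → coeff (placeExponents i a) (monomialQSymPoly n α) ≠ 0 →
      coeff (placeExponents i a) (monomialQSymPoly n α)
        = coeff (placeExponents j a) (monomialQSymPoly n α) := by
    intro k a ha i j hi hj h
    obtain ⟨i', hi', h'⟩ := exists_of_coeff_monomialQSymPoly_ne_zero h
    have hk := length_eq_of_placeExponents_eq hi hi' ha hpos h'
    subst hk
    obtain ⟨rfl, rfl⟩ := placeExponents_inj hi hi' ha hpos h'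
    rw [coeff_monomialQSymPoly n hα hi, coeff_monomialQSymPoly n hα hj]
  intro k a ha i j hi hj
  by_cases h : coeff (placeExponents i a) (monomialQSymPoly n α) = 0
  · by_cases h' : coeff (placeExponents j a) (monomialQSymPoly n α) = 0
    · exact h.trans h'.symm
    · exact (key k a ha j i hj hi h').symm
  · exact key k a ha i j hi hj h

theorem exists_eq_placeExponents {n : ℕ} (m : Fin n →₀ ℕ) : ∃ α : List ℕ, (∀ a ∈ α, 0 < a) ∧
    ∃ i : Fin α.length → Fin n, StrictMono i ∧ m = placeExponents i α.get := by
  classical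
  set s := m.support.sort (· ≤ ·) with hs
  refine ⟨s.map m, ?_, fun t => m.support.orderEmbOfFin (by simp [hs]) t, ?_, ?_⟩
  · intro a ha
    obtain ⟨v, hv, rfl⟩ := List.mem_map.mp ha
    rw [hs, Finset.mem_sort, Finsupp.mem_support_iff] at hv
    exact Nat.pos_of_ne_zero hv
  · exact (m.support.orderEmbOfFin _).strictMono
  · have hmono : StrictMono fun t => m.support.orderEmbOfFin
        (by simp [hs] : m.support.card = (s.map m).length) t :=
      (m.support.orderEmbOfFin _).strictMono
    ext v
    by_cases hv : v ∈ m.support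
    · have : v ∈ Set.range (m.support.orderEmbOfFin
          (by simp [hs] : m.support.card = (s.map m).length)) := by
        rw [Finset.range_orderEmbOfFin]
        exact hv
      obtain ⟨t, rfl⟩ := this
      rw [placeExponents_apply hmono]
      simp [Finset.orderEmbOfFin_apply, hs]
    · rw [placeExponents_eq_zero]
      · exact Finsupp.notMem_support_iff.mp hv
      · rintro ⟨t, rfl⟩
        exact hv (Finset.orderEmbOfFin_mem _ _ _)

/-- The ideal generated by the monomial quasisymmetric polynomials of positive degree. -/
def qsymIdeal (n : ℕ) : Ideal (MvPolynomial (Fin n) ℚ) :=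
  Ideal.span {p | ∃ α : List ℕ, α ≠ [] ∧ (∀ a ∈ α, 0 < a) ∧ α.length ≤ n ∧
    p = monomialQSymPoly n α}

theorem monomialQSymPoly_mem_qsymIdeal (n : ℕ) {α : List ℕ} (h0 : α ≠ []) (hα : ∀ a ∈ α, 0 < a) :
    monomialQSymPoly n α ∈ qsymIdeal n := by
  by_cases h : α.length ≤ n
  · exact Ideal.subset_span ⟨α, h0, hα, h, rfl⟩
  · rw [monomialQSymPoly, monomialQSym_eq_zero _ _ (by simpa using h)]
    exact zero_mem _

/-- Induction on the size of the support: all monomials of `M_α` have the same coefficient in `f`,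
so subtracting this multiple of `M_α` deletes them and creates no new ones. -/
theorem mem_qsymIdeal_of_mem_QSymPos {n : ℕ} {f : MvPolynomial (Fin n) ℚ} (hf : f ∈ QSymPos n) :
    f ∈ qsymIdeal n := by
  classical
  induction hk : f.support.card using Nat.strong_induction_on generalizing f with
  | _ k ih =>
    rcases f.support.eq_empty_or_nonempty with h | ⟨m, hm⟩
    · rw [support_eq_empty.mp h]
      exact zero_mem _
    · obtain ⟨hq, hc⟩ := hf
      obtain ⟨α, hα, i, hi, hmi⟩ := exists_eq_placeExponents m
      have hpos : ∀ t, 0 < α.get t := fun t => hα _ (List.get_mem _ _)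
      have h0 : α ≠ [] := by
        rintro rfl
        rw [mem_support_iff, hmi] at hm
        exact hm hc
      set g := f - C (coeff m f) * monomialQSymPoly n α with hg
      have hsub : g.support ⊆ f.support.erase m := by
        intro m' hm'
        rw [mem_support_iff, hg, coeff_sub, coeff_C_mul] at hm'
        rw [Finset.mem_erase, mem_support_iff]
        constructor
        · rintro rfl
          apply hm'
          rw [hmi, coeff_monomialQSymPoly n hα hi, mul_one, sub_self]
        · intro h
          rw [h, zero_sub, neg_ne_zero] at hm'
          obtain ⟨j, hj, rfl⟩ :=
            exists_of_coeff_monomialQSymPoly_ne_zero (right_ne_zero_of_mul hm')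
          have := hq _ α.get hpos i j hi hj
          change coeff (placeExponents i α.get) f = coeff (placeExponents j α.get) f at this
          rw [mem_support_iff, hmi, this] at hm
          exact hm h
      have hgK : g ∈ qsymIdeal n := by
        refine ih _ ?_ (f := g) ⟨?_, ?_⟩ rfl
        · rw [← hk]
          exact (Finset.card_le_card hsub).trans_lt (Finset.card_erase_lt_of_mem hm)
        · intro k a ha i j hi hj
          rw [hg, coeff_sub, coeff_sub, coeff_C_mul, coeff_C_mul, hq k a ha i j hi hj,
            isQuasisymmetric_monomialQSymPoly n hα k a ha i j hi hj]
        · by_contra h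
          have h2 := hsub (mem_support_iff.mpr h)
          rw [Finset.mem_erase, mem_support_iff] at h2
          exact h2.2 hc
      have : f = g + C (coeff m f) * monomialQSymPoly n α := by rw [hg, sub_add_cancel]
      rw [this]
      exact add_mem hgK (Ideal.mul_mem_left _ _ (monomialQSymPoly_mem_qsymIdeal n h0 hα))

theorem sum_pos_of_ne_nil {α : List ℕ} (h0 : α ≠ []) (hα : ∀ a ∈ α, 0 < a) : 0 < α.sum := by
  obtain ⟨a, w, rfl⟩ := List.exists_cons_of_ne_nil h0
  have := hα a (by simp)
  simp only [List.sum_cons]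
  omega

theorem span_QSymPos (n : ℕ) : Ideal.span (QSymPos n) = qsymIdeal n := by
  apply le_antisymm
  · exact Ideal.span_le.mpr fun f hf => mem_qsymIdeal_of_mem_QSymPos hf
  · apply Ideal.span_mono
    rintro _ ⟨α, h0, hα, -, rfl⟩
    refine ⟨isQuasisymmetric_monomialQSymPoly n hα, ?_⟩
    by_contra h
    have := monomialQSymPoly_isHomogeneous n α h
    simp at this
    exact (sum_pos_of_ne_nil h0 hα).ne this

theorem monomialQSymPoly_ne_zero {n : ℕ} {α : List ℕ} (hα : ∀ a ∈ α, 0 < a) (h : α.length ≤ n) :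
    monomialQSymPoly n α ≠ 0 := by
  intro h0
  have := coeff_monomialQSymPoly n hα (Fin.strictMono_castLE h)
  rw [h0, coeff_zero] at this
  exact zero_ne_one this

theorem homogeneousComponent_mem_qsymIdeal {n : ℕ} {p : MvPolynomial (Fin n) ℚ}
    (hp : p ∈ qsymIdeal n) (d : ℕ) : homogeneousComponent d p ∈ qsymIdeal n := by
  let _ : GradedAlgebra (homogeneousSubmodule (Fin n) ℚ) := gradedAlgebra
  refine homogeneousComponent_mem_of_mem (Ideal.homogeneous_span _ _ ?_) hp d
  rintro _ ⟨α, -, -, -, rfl⟩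
  exact ⟨_, monomialQSymPoly_isHomogeneous n α⟩

end

/-! ### Reduction to monomials below the diagonal -/

noncomputable section

open MvPolynomial

/-- The compositions indexing the expansion of a fundamental quasisymmetric function in monomial
ones. -/
def refinements : List ℕ → List (List ℕ)
  | [] => [[]]
  | 0 :: w => refinements w
  | 1 :: w => (refinements w).map (1 :: ·)
  | (a + 2) :: w => (refinements ((a + 1) :: w)).flatMap fun γ => match γ with
      | [] => []
      | g :: γ' => [1 :: g :: γ', (g + 1) :: γ']
termination_by w => (w.length, w.sum)

theorem pos_of_mem_refinements {α γ : List ℕ} (hγ : γ ∈ refinements α) : ∀ a ∈ γ, 0 < a := by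
  induction α using refinements.induct generalizing γ with
  | case1 =>
    rw [refinements, List.mem_singleton] at hγ
    simp [hγ]
  | case2 w ih =>
    rw [refinements] at hγ
    exact ih hγ
  | case3 w ih =>
    rw [refinements] at hγ
    obtain ⟨δ, hδ, rfl⟩ := List.mem_map.mp hγ
    exact List.forall_mem_cons.mpr ⟨one_pos, ih hδ⟩
  | case4 a w ih =>
    rw [refinements] at hγ
    obtain ⟨δ, hδ, hγ⟩ := List.mem_flatMap.mp hγ
    have h := ih hδ
    rcases δ with _ | ⟨g, δ⟩
    · simp at hγ
    · rw [List.forall_mem_cons] at h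
      simp only [List.mem_cons, List.not_mem_nil, or_false] at hγ
      rcases hγ with rfl | rfl
      · simpa using h
      · simpa using h.2

theorem nil_notMem_refinements (a : ℕ) (w : List ℕ) : [] ∉ refinements ((a + 1) :: w) := by
  rcases a with _ | a
  · simp [refinements]
  · rw [refinements]
    intro h
    obtain ⟨δ, -, h⟩ := List.mem_flatMap.mp h
    rcases δ with _ | ⟨g, δ⟩ <;> simp at h

/-- The fundamental quasisymmetric function of a list of variables. -/
def fundamentalQSym {R : Type*} [CommRing R] (l : List R) (α : List ℕ) : R :=
  ((refinements α).map (monomialQSym l)).sum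

section

variable {R : Type*} [CommRing R]

@[simp] theorem fundamentalQSym_nil (l : List R) : fundamentalQSym l [] = 1 := by
  simp [fundamentalQSym, refinements]

theorem fundamentalQSym_one_cons (x : R) (l : List R) (w : List ℕ) :
    fundamentalQSym (x :: l) (1 :: w) = x * fundamentalQSym l w + fundamentalQSym l (1 :: w) := by
  simp only [fundamentalQSym, refinements, List.map_map, ← List.sum_map_mul_left,
    ← List.sum_map_add]
  refine congrArg List.sum (List.map_congr_left fun γ _ => ?_)
  simp [add_comm]

/-- The refinements `1 :: g :: γ'` and `(g + 1) :: γ'` pair up: their terms containing `x` add up to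
`x` times the function of `g :: γ'`. Thus `x` may be used repeatedly within the first part. -/
theorem fundamentalQSym_add_two_cons (x : R) (l : List R) (a : ℕ) (w : List ℕ) :
    fundamentalQSym (x :: l) ((a + 2) :: w)
      = x * fundamentalQSym (x :: l) ((a + 1) :: w) + fundamentalQSym l ((a + 2) :: w) := by
  simp only [fundamentalQSym, refinements, List.map_flatMap, sum_flatMap_eq,
    ← List.sum_map_mul_left, ← List.sum_map_add]
  refine congrArg List.sum (List.map_congr_left fun γ hγ => ?_)
  rcases γ with _ | ⟨g, γ⟩
  · exact absurd hγ (nil_notMem_refinements a w)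
  · simp
    ring

theorem fundamentalQSym_cons (x : R) (l : List R) (b : ℕ) (w : List ℕ) :
    fundamentalQSym (x :: l) ((b + 1) :: w) = x ^ (b + 1) * fundamentalQSym l w
      + ∑ t ∈ Finset.range (b + 1), x ^ t * fundamentalQSym l ((b + 1 - t) :: w) := by
  induction b with
  | zero => simp [fundamentalQSym_one_cons]
  | succ b ih =>
    rw [fundamentalQSym_add_two_cons, ih, Finset.sum_range_succ' _ (b + 1), mul_add,
      Finset.mul_sum, pow_succ' x (b + 1)]
    simp only [Nat.add_sub_add_right, pow_succ' x, pow_zero, Nat.sub_zero, one_mul, mul_assoc,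
      ← add_assoc]

theorem monomialQSym_mem {S : Type*} [SetLike S R] [SubringClass S R] (A : S) {l : List R}
    (hl : ∀ x ∈ l, x ∈ A) (w : List ℕ) : monomialQSym l w ∈ A := by
  induction l generalizing w with
  | nil =>
    cases w with
    | nil => exact one_mem A
    | cons a w => exact zero_mem A
  | cons x l ih =>
    rw [List.forall_mem_cons] at hl
    cases w with
    | nil => simp
    | cons a w => exact add_mem (ih hl.2 _) (mul_mem (pow_mem hl.1 a) (ih hl.2 _))

theorem fundamentalQSym_mem {S : Type*} [SetLike S R] [SubringClass S R] (A : S) {l : List R}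
    (hl : ∀ x ∈ l, x ∈ A) (w : List ℕ) : fundamentalQSym l w ∈ A := by
  apply list_sum_mem
  intro r hr
  obtain ⟨γ, -, rfl⟩ := List.mem_map.mp hr
  exact monomialQSym_mem A hl γ

end

theorem fundamentalQSym_mem_qsymIdeal (n : ℕ) {α : List ℕ} (h0 : α ≠ [])
    (hα : ∀ a ∈ α, 0 < a) : fundamentalQSym (List.ofFn X) α ∈ qsymIdeal n := by
  apply list_sum_mem
  intro r hr
  obtain ⟨γ, hγ, rfl⟩ := List.mem_map.mp hr
  refine monomialQSymPoly_mem_qsymIdeal n ?_ (pos_of_mem_refinements hγ)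
  rintro rfl
  obtain ⟨a, w, rfl⟩ := List.exists_cons_of_ne_nil h0
  obtain ⟨b, rfl⟩ := Nat.exists_eq_add_of_le' (hα a (by simp))
  exact nil_notMem_refinements b w hγ

/-- The sum of the first `k` entries. -/
def prefixSum {n : ℕ} (e : Fin n →₀ ℕ) (k : ℕ) : ℕ :=
  ∑ v ∈ Finset.univ.filter (fun v : Fin n => (v : ℕ) < k), e v

/-- The exponent vectors below the diagonal, of which there are Catalan many. -/
def IsDyck {n : ℕ} (e : Fin n →₀ ℕ) : Prop := ∀ k, 1 ≤ k → k ≤ n → prefixSum e k < k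

/-- The monomial formed by the first `k` variables. -/
def prefixMonomial {n : ℕ} (e : Fin n →₀ ℕ) (k : ℕ) : MvPolynomial (Fin n) ℚ :=
  ∏ v ∈ Finset.univ.filter (fun v : Fin n => (v : ℕ) < k), X v ^ e v

theorem filter_lt_succ {n k : ℕ} (hk : k < n) :
    Finset.univ.filter (fun v : Fin n => (v : ℕ) < k + 1)
      = insert ⟨k, hk⟩ (Finset.univ.filter fun v : Fin n => (v : ℕ) < k) := by
  ext v
  simp only [Finset.mem_filter, Finset.mem_univ, true_and, Finset.mem_insert, Fin.ext_iff]
  omega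

theorem prefixSum_zero {n : ℕ} (e : Fin n →₀ ℕ) : prefixSum e 0 = 0 := by simp [prefixSum]

theorem prefixSum_succ {n k : ℕ} (e : Fin n →₀ ℕ) (hk : k < n) :
    prefixSum e (k + 1) = prefixSum e k + e ⟨k, hk⟩ := by
  rw [prefixSum, filter_lt_succ hk, Finset.sum_insert (by simp), add_comm, prefixSum]

theorem prefixMonomial_zero {n : ℕ} (e : Fin n →₀ ℕ) : prefixMonomial e 0 = 1 := by
  simp [prefixMonomial]

theorem prefixMonomial_succ {n k : ℕ} (e : Fin n →₀ ℕ) (hk : k < n) :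
    prefixMonomial e (k + 1) = prefixMonomial e k * X ⟨k, hk⟩ ^ e ⟨k, hk⟩ := by
  rw [prefixMonomial, filter_lt_succ hk, Finset.prod_insert (by simp), mul_comm, prefixMonomial]

theorem prefixMonomial_eq {n : ℕ} (e : Fin n →₀ ℕ) (k : ℕ) :
    prefixMonomial e k = monomial (e.filter fun v : Fin n => (v : ℕ) < k) 1 := by
  rw [monomial_eq, C_1, one_mul, Finsupp.prod_fintype _ _ (by simp), prefixMonomial,
    Finset.prod_filter]
  refine Finset.prod_congr rfl fun v _ => ?_
  rw [Finsupp.filter_apply]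
  split_ifs <;> simp

/-- The polynomials in the variables after the first `k`. -/
abbrev laterVars (n k : ℕ) : Subalgebra ℚ (MvPolynomial (Fin n) ℚ) :=
  supported ℚ {v : Fin n | k ≤ v}

theorem laterVars_anti {n k : ℕ} : laterVars n (k + 1) ≤ laterVars n k :=
  supported_mono fun _ hv => Nat.le_of_succ_le hv

theorem mem_laterVars_of_mem_drop {n k : ℕ} {x : MvPolynomial (Fin n) ℚ}
    (hx : x ∈ (List.ofFn X : List (MvPolynomial (Fin n) ℚ)).drop k) : x ∈ laterVars n k := by
  obtain ⟨i, hi, rfl⟩ := List.mem_iff_getElem.mp hx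
  rw [List.getElem_drop, List.getElem_ofFn, X_mem_supported]
  simp

/-- Monomials that are lexicographically smaller, with the first difference at the place `k`. -/
theorem prefix_mul_mem {n : ℕ} (N : Submodule ℚ (MvPolynomial (Fin n) ℚ)) (e : Fin n →₀ ℕ)
    (hN : ∀ δ : Fin n →₀ ℕ, toLex δ < toLex e → monomial δ 1 ∈ N) {k : ℕ} (hk : k < n) {c : ℕ}
    (hc : c < e ⟨k, hk⟩) {p : MvPolynomial (Fin n) ℚ} (hp : p ∈ laterVars n (k + 1)) :
    prefixMonomial e k * X ⟨k, hk⟩ ^ c * p ∈ N := by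
  rw [← p.support_sum_monomial_coeff, Finset.mul_sum]
  refine sum_mem fun m hm => ?_
  rw [prefixMonomial_eq, X_pow_eq_monomial, monomial_mul, monomial_mul, one_mul, one_mul,
    ← mul_one (coeff m p), ← smul_eq_mul (coeff m p), ← smul_monomial]
  refine N.smul_mem _ (hN _ ?_)
  have hm0 : ∀ v : Fin n, (v : ℕ) < k + 1 → m v = 0 := by
    intro v hv
    by_contra h
    have : v ∈ p.vars := (mem_vars_iff_mem_support v).mpr ⟨m, hm, Finsupp.mem_support_iff.mpr h⟩
    have := mem_supported.mp hp (Finset.mem_coe.mpr this)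
    simp only [Set.mem_ofPred_eq] at this
    omega
  rw [Finsupp.Lex.lt_iff]
  refine ⟨⟨k, hk⟩, fun v hv => ?_, ?_⟩
  · have hv' : (v : ℕ) < k := hv
    simp [hv', hm0 v (by omega), Fin.ext_iff, hv'.ne']
  · simpa [Finsupp.filter_apply, hm0 ⟨k, hk⟩ (Nat.lt_succ_self k)] using hc

/-- The first `k` exponents are traded, from the last to the first, for parts of `α`, until at `k =
0` a fundamental function with nonempty index remains, which lies in the ideal. The inequality
`hsum` survives each trade and prevents arriving at `k = 0` with `α` empty. The free factor `q`
absorbs variables released on the way. -/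
theorem prefix_mul_fundamentalQSym_mem {n : ℕ} (N : Submodule ℚ (MvPolynomial (Fin n) ℚ))
    (hK : ∀ p ∈ qsymIdeal n, p ∈ N) (e : Fin n →₀ ℕ)
    (hN : ∀ δ : Fin n →₀ ℕ, toLex δ < toLex e → monomial δ 1 ∈ N) (k : ℕ) (hk : k ≤ n)
    (α : List ℕ) (hα : ∀ a ∈ α, 0 < a) (hne : k ≠ 0 ∨ α ≠ [])
    (hsum : k + α.length ≤ prefixSum e k + α.sum)
    {q : MvPolynomial (Fin n) ℚ} (hq : q ∈ laterVars n k) :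
    prefixMonomial e k * fundamentalQSym ((List.ofFn X).drop k) α * q ∈ N := by
  induction k generalizing α q with
  | zero =>
    apply hK
    rw [prefixMonomial_zero, one_mul, List.drop_zero]
    refine Ideal.mul_mem_right _ _ (fundamentalQSym_mem_qsymIdeal n ?_ hα)
    simpa using hne
  | succ k ih =>
    have hk' : k < n := hk
    have hdrop : (List.ofFn X : List (MvPolynomial (Fin n) ℚ)).drop k
        = X ⟨k, hk'⟩ :: (List.ofFn X).drop (k + 1) := by
      rw [List.drop_eq_getElem_cons (by simpa using hk')]
      simp
    rw [prefixSum_succ e hk'] at hsum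
    rw [prefixMonomial_succ e hk']
    rw [hdrop] at ih
    set l : List (MvPolynomial (Fin n) ℚ) := (List.ofFn X).drop (k + 1) with hl
    rcases Nat.eq_zero_or_pos (e ⟨k, hk'⟩) with h0 | hb
    · rw [h0, pow_zero, mul_one]
      rw [h0, add_zero] at hsum
      have hx : (X ⟨k, hk'⟩ : MvPolynomial (Fin n) ℚ) ∈ laterVars n k := by
        rw [X_mem_supported]
        exact le_refl k
      -- The recursions for a zero exponent multiply `q` by the variable at `k`, so `q` must be
      -- allowed to contain it.
      replace hq := laterVars_anti hq
      clear hne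
      induction α generalizing q with
      | nil =>
        -- Here `k ≠ 0`, since for `k = 0` the inequality `hsum` would read `1 ≤ 0`.
        have := ih hk'.le [] hα (Or.inl (by
          rintro rfl
          rw [prefixSum_zero] at hsum
          simp at hsum)) (by simp at hsum ⊢; omega) hq
        simpa using this
      | cons a w ihw =>
        have hw := List.forall_mem_cons.mp hα
        simp only [List.length_cons, List.sum_cons] at hsum
        obtain ⟨b, rfl⟩ := Nat.exists_eq_add_of_le' hw.1
        have h1 := ih hk'.le _ hα (Or.inr (by simp))
          (by simp only [List.length_cons, List.sum_cons]; omega) hq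
        rcases b with _ | b
        · rw [zero_add, fundamentalQSym_one_cons] at h1
          have h2 := ihw hw.2 (by omega) (mul_mem hx hq)
          have := sub_mem h1 h2
          convert this using 1
          ring
        · rw [fundamentalQSym_add_two_cons] at h1
          have h2 := ih hk'.le ((b + 1) :: w)
            (List.forall_mem_cons.mpr ⟨Nat.succ_pos b, hw.2⟩) (Or.inr (by simp))
            (by simp only [List.length_cons, List.sum_cons]; omega) (mul_mem hx hq)
          have := sub_mem h1 h2
          convert this using 1
          ring
    -- The exponent becomes a new first part. Expanding in the variable at `k`, the full power gives
    -- the desired term, and every lower power gives lexicographically smaller monomials, already in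
    -- `N`.
    · have h1 := ih hk'.le (e ⟨k, hk'⟩ :: α) (List.forall_mem_cons.mpr ⟨hb, hα⟩)
        (Or.inr (by simp)) (by simp only [List.length_cons, List.sum_cons]; omega)
        (laterVars_anti hq)
      have h2 : ∀ t ∈ Finset.range (e ⟨k, hk'⟩), prefixMonomial e k * X ⟨k, hk'⟩ ^ t
          * (fundamentalQSym l ((e ⟨k, hk'⟩ - t) :: α) * q) ∈ N := by
        intro t ht
        refine prefix_mul_mem N e hN hk' (Finset.mem_range.mp ht) (mul_mem ?_ hq)
        exact fundamentalQSym_mem _ (fun x hx => mem_laterVars_of_mem_drop hx) _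
      have h3 := sub_mem h1 (sum_mem h2)
      obtain ⟨b, hb'⟩ := Nat.exists_eq_add_of_le' hb
      rw [hb'] at h3 ⊢
      convert h3 using 1
      rw [fundamentalQSym_cons, mul_add, add_mul, Finset.mul_sum, Finset.sum_mul,
        add_sub_assoc, ← Finset.sum_sub_distrib, Finset.sum_eq_zero (fun t _ => by ring)]
      ring

/-- Well-founded induction in lexicographic order. If the condition fails at `k`, the preceding
lemma applies with `α` empty and `q` the part of the monomial in the later variables. -/
theorem monomial_mem_of_dyck {n : ℕ} (N : Submodule ℚ (MvPolynomial (Fin n) ℚ))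
    (hK : ∀ p ∈ qsymIdeal n, p ∈ N) (hD : ∀ e : Fin n →₀ ℕ, IsDyck e → monomial e 1 ∈ N)
    (e : Fin n →₀ ℕ) : monomial e 1 ∈ N := by
  have key : ∀ e' : Lex (Fin n →₀ ℕ), monomial (ofLex e') 1 ∈ N := by
    intro e'
    induction e' using WellFoundedLT.induction with
    | ind e' ih =>
      by_cases hd : IsDyck (ofLex e')
      · exact hD _ hd
      · unfold IsDyck at hd
        push Not at hd
        obtain ⟨k, hk1, hkn, hk⟩ := hd
        have hq : (monomial ((ofLex e').filter fun v : Fin n => ¬ (v : ℕ) < k) 1 :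
            MvPolynomial (Fin n) ℚ) ∈ laterVars n k := by
          rw [mem_supported, vars_monomial one_ne_zero]
          intro v hv
          have := (Finsupp.mem_support_iff.mp (Finset.mem_coe.mp hv))
          rw [Finsupp.filter_apply] at this
          by_contra h
          exact this (if_neg (by simpa using h))
        have := prefix_mul_fundamentalQSym_mem N hK (ofLex e') (fun δ hδ => ih (toLex δ) hδ) k hkn
          [] (by simp) (Or.inl (by omega)) (by simpa using hk) hq
        rwa [fundamentalQSym_nil, mul_one, prefixMonomial_eq, monomial_mul, one_mul,
          Finsupp.filter_add_filter_not] at this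
  exact key (toLex e)

/-- The span of the monomials with exponent vectors below the diagonal. -/
def dyckSpan (n : ℕ) : Submodule ℚ (MvPolynomial (Fin n) ℚ) :=
  restrictSupport ℚ {e | IsDyck e}

theorem exists_add_dyck {n : ℕ} (p : MvPolynomial (Fin n) ℚ) :
    ∃ q ∈ qsymIdeal n, ∃ s ∈ dyckSpan n, p = q + s := by
  have h : p ∈ (qsymIdeal n).restrictScalars ℚ ⊔ dyckSpan n := by
    rw [← p.support_sum_monomial_coeff]
    refine sum_mem fun m _ => ?_
    rw [← mul_one (coeff m p), ← smul_eq_mul (coeff m p), ← smul_monomial]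
    refine Submodule.smul_mem _ _ (monomial_mem_of_dyck _ (fun p hp => ?_) (fun e he => ?_) m)
    · exact Submodule.mem_sup_left hp
    · exact Submodule.mem_sup_right ((monomial_mem_restrictSupport ℚ).mpr (Or.inl he))
  obtain ⟨q, hq, s, hs, rfl⟩ := Submodule.mem_sup.mp h
  exact ⟨q, hq, s, hs, rfl⟩

end

/-! ### From exponent vectors below the diagonal to `QSV_n` -/

noncomputable section

open MvPolynomial

namespace NoncrossingPartition

variable {n : ℕ}

theorem qFun_eq_and_lt_iff (L : NoncrossingPartition n) (i j : Fin n) :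
    L.qFun j = i ∧ i < j ↔ (i, j) ∈ L.arcs := by
  constructor
  · rintro ⟨rfl, h⟩
    by_cases hj : ∃ i, (i, j) ∈ L.arcs
    · obtain ⟨i, hi⟩ := hj
      rwa [L.qFun_of_mem hi]
    · push Not at hj
      exact absurd ((L.qFun_of_not_mem hj).2 j (SimpleGraph.Reachable.refl j)) (not_le.mpr h)
  · intro h
    exact ⟨L.qFun_of_mem h, L.lt_of_mem _ h⟩

theorem arcs_eq_of_qPerm_eq {L L' : NoncrossingPartition n} (h : L.qPerm = L'.qPerm) :
    L.arcs = L'.arcs := by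
  have hq : L.qFun = L'.qFun := congrArg (fun σ : Equiv.Perm (Fin n) => (σ : Fin n → Fin n)) h
  ext ⟨i, j⟩
  rw [← qFun_eq_and_lt_iff, ← qFun_eq_and_lt_iff, hq]

open Classical in
/-- The noncrossing partition with arcs between consecutive places at the same level of a height
function, if the heights between them are larger. -/
def ofHeight (h : Fin n → ℤ) : NoncrossingPartition n where
  arcs := Finset.univ.filter fun p =>
    p.1 < p.2 ∧ h p.1 = h p.2 ∧ ∀ m, p.1 < m → m < p.2 → h p.2 < h m
  lt_of_mem p hp := (Finset.mem_filter.mp hp).2.1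
  noncrossing := by
    rintro ⟨i, k⟩ hp ⟨j, l⟩ hq hne ⟨h1, h2, h3⟩
    obtain ⟨-, p1, p2, p3⟩ := Finset.mem_filter.mp hp
    obtain ⟨-, q1, q2, q3⟩ := Finset.mem_filter.mp hq
    simp only at *
    rcases h1.lt_or_eq with h1 | rfl
    · have a := p3 j h1 h2
      rcases h3.lt_or_eq with h3 | rfl
      · have b := q3 k h2 h3
        omega
      · omega
    · rcases h3.lt_or_eq with h3 | rfl
      · have b := q3 k h2 h3
        omega
      · exact hne rfl

theorem mem_ofHeight {h : Fin n → ℤ} {i j : Fin n} : (i, j) ∈ (ofHeight h).arcs ↔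
    i < j ∧ h i = h j ∧ ∀ m, i < m → m < j → h j < h m := by
  simp [ofHeight]

end NoncrossingPartition

/-- The height after `k` steps. -/
def dyckHeight {n : ℕ} (e : Fin n →₀ ℕ) (k : ℕ) : ℤ := k - prefixSum e k

theorem dyckHeight_succ {n : ℕ} (e : Fin n →₀ ℕ) (j : Fin n) :
    dyckHeight e (j + 1) = dyckHeight e j + 1 - e j := by
  rw [dyckHeight, dyckHeight, prefixSum_succ e j.2]
  push_cast
  ring

/-- The noncrossing partition of an exponent vector. -/
def dyckPartition {n : ℕ} (e : Fin n →₀ ℕ) : NoncrossingPartition n :=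
  .ofHeight fun j => dyckHeight e (j + 1)

/-- Heights rise by at most one per step, and the step at `j` does not rise. So the last earlier
vertex of height at most that of `j` has exactly that height. One exists because the first vertex
has height at most `1`, and all heights are at least `1`. -/
theorem IsDyck.exists_arc {n : ℕ} {e : Fin n →₀ ℕ} (he : IsDyck e) {j : Fin n} (hj : e j ≠ 0) :
    ∃ i, (i, j) ∈ (dyckPartition e).arcs := by
  classical
  have hpos : ∀ k, 1 ≤ k → k ≤ n → 1 ≤ dyckHeight e k := fun k h1 h2 => by
    have := he k h1 h2
    unfold dyckHeight
    omega
  have hstep := dyckHeight_succ e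
  have hj1 := hpos (j + 1) (by omega) (by omega)
  have h0 : dyckHeight e 0 = 0 := by simp [dyckHeight, prefixSum_zero]
  have hj0 : (j : ℕ) ≠ 0 := by
    intro h
    have := hstep j
    rw [h] at this hj1
    omega
  have hn : 0 < n := by omega
  set s := Finset.univ.filter fun i : Fin n =>
    i < j ∧ dyckHeight e (i + 1) ≤ dyckHeight e (j + 1) with hs
  have hne : s.Nonempty := by
    refine ⟨⟨0, hn⟩, Finset.mem_filter.mpr ⟨Finset.mem_univ _, ?_, ?_⟩⟩
    · rw [Fin.lt_def]
      simp only
      omega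
    · have := hstep ⟨0, hn⟩
      simp only at this ⊢
      omega
  obtain ⟨i, hi, hmax⟩ := Finset.exists_max_image s id hne
  obtain ⟨-, hij, hle⟩ := Finset.mem_filter.mp hi
  have hbetween : ∀ m, i < m → m < j → dyckHeight e (j + 1) < dyckHeight e (m + 1) := by
    intro m h1 h2
    by_contra h
    exact absurd (hmax m (Finset.mem_filter.mpr ⟨Finset.mem_univ _, h2, not_lt.mp h⟩))
      (not_le.mpr h1)
  refine ⟨i, NoncrossingPartition.mem_ofHeight.mpr ⟨hij, le_antisymm hle ?_, hbetween⟩⟩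
  have hij' : (i : ℕ) < j := hij
  by_cases h : (i : ℕ) + 1 = j
  · have := hstep j
    rw [h]
    omega
  · have h1 := hbetween ⟨i + 1, by omega⟩ (by simp [Fin.lt_def]) (by simp [Fin.lt_def]; omega)
    have h2 := hstep ⟨i + 1, by omega⟩
    simp only at h1 h2
    omega

/-- The arcs determine the heights from left to right: a right endpoint has the height of its left
neighbour, and at any other vertex the exponent is zero and the height rises by one. -/
theorem IsDyck.eq_of_arcs_eq {n : ℕ} {e e' : Fin n →₀ ℕ} (he : IsDyck e) (he' : IsDyck e')
    (h : (dyckPartition e).arcs = (dyckPartition e').arcs) : e = e' := by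
  have key : ∀ k ≤ n, dyckHeight e k = dyckHeight e' k := by
    intro k
    induction k using Nat.strong_induction_on with
    | _ k ih =>
      intro hk
      rcases k with _ | k
      · simp [dyckHeight, prefixSum_zero]
      · by_cases hex : ∃ i, (i, (⟨k, hk⟩ : Fin n)) ∈ (dyckPartition e).arcs
        · obtain ⟨i, hi⟩ := hex
          have hi' := hi
          rw [h] at hi'
          obtain ⟨h1, h2, -⟩ := NoncrossingPartition.mem_ofHeight.mp hi
          obtain ⟨-, h3, -⟩ := NoncrossingPartition.mem_ofHeight.mp hi'
          have h1' : (i : ℕ) < k := h1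
          have := ih (i + 1) (by omega) (by omega)
          simp only at h2 h3
          rw [← h2, ← h3, this]
        · have h1 : e ⟨k, hk⟩ = 0 := by
            by_contra h'
            exact hex (he.exists_arc h')
          have h2 : e' ⟨k, hk⟩ = 0 := by
            by_contra h'
            rw [h] at hex
            exact hex (he'.exists_arc h')
          have s1 := dyckHeight_succ e ⟨k, hk⟩
          have s2 := dyckHeight_succ e' ⟨k, hk⟩
          have := ih k (by omega) (by omega)
          simp only at s1 s2
          rw [s1, s2, h1, h2, this]
  ext j
  have s1 := dyckHeight_succ e j
  have s2 := dyckHeight_succ e' j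
  have h1 := key (j + 1) (by omega)
  have h2 := key j (by omega)
  omega

theorem permPoint_injective {n : ℕ} : Function.Injective (permPoint (n := n)) := by
  intro σ τ h
  ext j
  have := congrFun h j
  simpa [permPoint] using this

instance finite_QSVPoints (n : ℕ) : Finite (QSVPoints n) :=
  ((Set.toFinite (QSV n)).image _).to_subtype

/-- The point of `QSV_n` of an exponent vector below the diagonal. -/
def dyckPoint {n : ℕ} (e : {e : Fin n →₀ ℕ | IsDyck e}) : QSVPoints n :=
  ⟨permPoint (dyckPartition e.1).qPerm, Set.mem_image_of_mem _ ⟨_, rfl⟩⟩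

theorem dyckPoint_injective {n : ℕ} : Function.Injective (dyckPoint (n := n)) := by
  intro e e' h
  have h1 := permPoint_injective (congrArg Subtype.val h)
  exact Subtype.ext (e.2.eq_of_arcs_eq e'.2 (NoncrossingPartition.arcs_eq_of_qPerm_eq h1))

/-! ### Evaluation on `QSV_n` and the dimension squeeze -/

/-- Evaluation at the points of a set. -/
def evalAt {n : ℕ} (P : Set (Fin n → ℚ)) : MvPolynomial (Fin n) ℚ →ₗ[ℚ] (P → ℚ) :=
  LinearMap.pi fun x => (aeval x.1).toLinearMap

theorem evalAt_apply {n : ℕ} (P : Set (Fin n → ℚ)) (p : MvPolynomial (Fin n) ℚ) (x : P) :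
    evalAt P p x = aeval x.1 p := rfl

theorem evalAt_eq_zero {n : ℕ} {P : Set (Fin n → ℚ)} {p : MvPolynomial (Fin n) ℚ} :
    evalAt P p = 0 ↔ p ∈ vanishingIdeal ℚ P := by
  rw [mem_vanishingIdeal_iff]
  constructor
  · intro h x hx
    exact congrFun h ⟨x, hx⟩
  · intro h
    funext x
    exact h x.1 x.2

/-- Lagrange interpolation: products of linear polynomials separating pairs of points. -/
theorem evalAt_surjective {n : ℕ} (P : Set (Fin n → ℚ)) [Finite P] :
    Function.Surjective (evalAt P) := by
  classical
  have := Fintype.ofFinite P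
  have sep : ∀ x y : P, ∃ p : MvPolynomial (Fin n) ℚ, aeval x.1 p = (1 : ℚ) ∧
      (x ≠ y → aeval y.1 p = (0 : ℚ)) := by
    intro x y
    by_cases h : x = y
    · exact ⟨1, by simp, fun h' => absurd h h'⟩
    · obtain ⟨i, hi⟩ := Function.ne_iff.mp (fun h' => h (Subtype.ext h'))
      exact ⟨C ((x.1 i - y.1 i)⁻¹) * (X i - C (y.1 i)), by simp [sub_ne_zero.mpr hi], by simp⟩
  choose p hp1 hp2 using sep
  intro f
  refine ⟨∑ x, C (f x) * ∏ y, p x y, funext fun z => ?_⟩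
  rw [evalAt_apply, map_sum, Finset.sum_eq_single z]
  · rw [map_mul, map_prod, Finset.prod_congr rfl fun y _ => hp1 z y]
    simp
  · intro x _ hx
    rw [map_mul, map_prod, Finset.prod_eq_zero (Finset.mem_univ z) (hp2 x z hx), mul_zero]
  · simp

/-- The ideal generated by the polynomials `P_α`. -/
def shiftedIdeal (n : ℕ) : Ideal (MvPolynomial (Fin n) ℚ) :=
  Ideal.span {p : MvPolynomial (Fin n) ℚ |
    ∃ (d : ℕ) (α : Composition d), 0 < d ∧ α.length ≤ n ∧ p = vanishingPoly n α}

theorem shiftedIdeal_le (n : ℕ) : shiftedIdeal n ≤ vanishingIdeal ℚ (QSVPoints n) := by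
  apply Ideal.span_le.mpr
  rintro _ ⟨d, α, hd, -, rfl⟩
  exact vanishingPoly_mem_vanishingIdeal n α hd

theorem sub_homogeneousComponent_mem_degreeLT {n d : ℕ} {p : MvPolynomial (Fin n) ℚ}
    (hp : p ∈ degreeLT n (d + 1)) : p - homogeneousComponent d p ∈ degreeLT n d := by
  rw [mem_degreeLT] at *
  intro m hm
  rw [mem_support_iff, coeff_sub, coeff_homogeneousComponent] at hm
  split_ifs at hm with h
  · exact absurd (sub_self _) hm
  · rw [sub_zero] at hm
    have := hp m (mem_support_iff.mpr hm)
    omega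

theorem homogeneousComponent_eq_zero_of_mem_degreeLT {n d : ℕ} {p : MvPolynomial (Fin n) ℚ}
    (hp : p ∈ degreeLT n d) : homogeneousComponent d p = 0 :=
  homogeneousComponent_eq_zero' _ _ fun m hm => (mem_degreeLT.mp hp m hm).ne

theorem homogeneousComponent_mem_dyckSpan {n : ℕ} {p : MvPolynomial (Fin n) ℚ}
    (hp : p ∈ dyckSpan n) (d : ℕ) : homogeneousComponent d p ∈ dyckSpan n := by
  rw [dyckSpan, mem_restrictSupport_iff] at *
  refine subset_trans ?_ hp
  rw [support_homogeneousComponent]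
  exact Finset.coe_subset.mpr (Finset.filter_subset _ _)

/-- In the degree-`d` part of a combination of the `M_α`, replacing each `M_α` by `P_α` changes only
terms of lower degree. -/
theorem exists_shiftedIdeal_sub_mem {n : ℕ} {q : MvPolynomial (Fin n) ℚ} (hq : q ∈ qsymIdeal n)
    (d : ℕ) : ∃ q' ∈ shiftedIdeal n, homogeneousComponent d q - q' ∈ degreeLT n d := by
  have key : ∀ ι : Finset (Fin n →₀ ℕ), ∀ f : (Fin n →₀ ℕ) → MvPolynomial (Fin n) ℚ,
      (∀ m ∈ ι, ∃ q' ∈ shiftedIdeal n, homogeneousComponent d (f m) - q' ∈ degreeLT n d) →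
      ∃ q' ∈ shiftedIdeal n, homogeneousComponent d (∑ m ∈ ι, f m) - q' ∈ degreeLT n d := by
    intro ι f h
    choose! g hg1 hg2 using h
    refine ⟨∑ m ∈ ι, g m, sum_mem hg1, ?_⟩
    rw [map_sum, ← Finset.sum_sub_distrib]
    exact sum_mem hg2
  induction hq using Submodule.closure_induction with
  | zero => exact ⟨0, zero_mem _, by simp⟩
  | add x y _ _ hx hy =>
    obtain ⟨x', h1, h2⟩ := hx
    obtain ⟨y', h3, h4⟩ := hy
    refine ⟨x' + y', add_mem h1 h3, ?_⟩
    rw [map_add, add_sub_add_comm]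
    exact add_mem h2 h4
  | smul_mem r x hx =>
    obtain ⟨α, h0, hα, hlen, rfl⟩ := hx
    rw [smul_eq_mul, ← r.support_sum_monomial_coeff, Finset.sum_mul]
    apply key
    intro m _
    have hm : (monomial m (coeff m r) : MvPolynomial (Fin n) ℚ).IsHomogeneous m.degree :=
      isHomogeneous_monomial _ rfl
    have hh := hm.mul (monomialQSymPoly_isHomogeneous n α)
    rw [homogeneousComponent_of_mem hh]
    split_ifs with hd
    · let c : Composition α.sum := ⟨α, fun {i} hi => hα i hi, rfl⟩
      refine ⟨monomial m (coeff m r) * vanishingPoly n c, Ideal.mul_mem_left _ _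
        (Ideal.subset_span ⟨_, c, sum_pos_of_ne_nil h0 hα, hlen, rfl⟩), ?_⟩
      rw [← mul_sub, hd]
      refine mul_mem_degreeLT (isHomogeneous_mem_degreeLT hm) ?_
      rw [← neg_sub]
      exact neg_mem (vanishingPoly_sub_mem_degreeLT n c)
    · exact ⟨0, zero_mem _, by simp⟩

theorem exists_add_dyck_of_mem_degreeLT {n d : ℕ} {p : MvPolynomial (Fin n) ℚ}
    (hp : p ∈ degreeLT n d) :
    ∃ q ∈ shiftedIdeal n, ∃ s ∈ dyckSpan n, s ∈ degreeLT n d ∧ p = q + s := by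
  induction d generalizing p with
  | zero =>
    have : p = 0 := by
      rw [← support_eq_empty, Finset.eq_empty_iff_forall_notMem]
      exact fun m hm => Nat.not_lt_zero _ (mem_degreeLT.mp hp m hm)
    exact ⟨0, zero_mem _, 0, zero_mem _, zero_mem _, by simp [this]⟩
  | succ d ih =>
    obtain ⟨q, hq, s, hs, hqs⟩ := exists_add_dyck p
    obtain ⟨q', hq', hlow⟩ := exists_shiftedIdeal_sub_mem hq d
    have hcomp := congrArg (homogeneousComponent d) hqs
    rw [map_add] at hcomp
    obtain ⟨j, hj, w, hw, hwd, hjw⟩ := ih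
      (add_mem hlow (sub_homogeneousComponent_mem_degreeLT hp))
    refine ⟨q' + j, add_mem hq' hj, homogeneousComponent d s + w,
      add_mem (homogeneousComponent_mem_dyckSpan hs d) hw,
      add_mem (isHomogeneous_mem_degreeLT (homogeneousComponent_isHomogeneous d s))
        (degreeLT_mono (Nat.le_succ d) hwd), ?_⟩
    rw [hcomp] at hjw
    linear_combination hjw

theorem mem_degreeLT_totalDegree {n : ℕ} (p : MvPolynomial (Fin n) ℚ) :
    p ∈ degreeLT n (p.totalDegree + 1) :=
  mem_degreeLT.mpr fun _ hm => Nat.lt_succ_of_le (le_totalDegree hm)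

/-- Evaluation maps the span onto all functions on `QSV_n`, because the shifted ideal evaluates to
zero. The injection of exponent vectors into points bounds the dimension of the span from above, so
evaluation is also injective. -/
theorem eq_zero_of_mem_dyckSpan {n : ℕ} {w : MvPolynomial (Fin n) ℚ} (hw : w ∈ dyckSpan n)
    (hv : w ∈ vanishingIdeal ℚ (QSVPoints n)) : w = 0 := by
  classical
  have := Fintype.ofFinite (QSVPoints n)
  have hfin : Finite {e : Fin n →₀ ℕ | IsDyck e} := Finite.of_injective _ dyckPoint_injective
  let b := basisRestrictSupport ℚ {e : Fin n →₀ ℕ | IsDyck e}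
  have : Module.Finite ℚ (dyckSpan n) := Module.Finite.of_basis b
  let f : dyckSpan n →ₗ[ℚ] (QSVPoints n → ℚ) := (evalAt (QSVPoints n)).domRestrict (dyckSpan n)
  have hsurj : Function.Surjective f := by
    intro g
    obtain ⟨p, rfl⟩ := evalAt_surjective (QSVPoints n) g
    obtain ⟨q, hq, s, hs, -, rfl⟩ :=
      exists_add_dyck_of_mem_degreeLT (mem_degreeLT_totalDegree p)
    refine ⟨⟨s, hs⟩, ?_⟩
    rw [map_add, evalAt_eq_zero.mpr (shiftedIdeal_le n hq), zero_add]
    rfl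
  have h1 : Module.finrank ℚ (dyckSpan n) ≤ Module.finrank ℚ (QSVPoints n → ℚ) := by
    rw [Module.finrank_fintype_fun_eq_card, ← Nat.card_eq_fintype_card,
      show Module.finrank ℚ (dyckSpan n) = _ from Module.finrank_eq_nat_card_basis b]
    exact Nat.card_le_card_of_injective _ dyckPoint_injective
  have h2 := LinearMap.finrank_le_finrank_of_surjective hsurj
  have hinj := (LinearMap.injective_iff_surjective_of_finrank_eq_finrank (le_antisymm h1 h2)).mpr
    hsurj
  have : f ⟨w, hw⟩ = 0 := evalAt_eq_zero.mpr hv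
  exact congrArg Subtype.val (hinj (this.trans (map_zero f).symm))

theorem shiftedIdeal_eq (n : ℕ) : shiftedIdeal n = vanishingIdeal ℚ (QSVPoints n) := by
  refine le_antisymm (shiftedIdeal_le n) fun p hp => ?_
  obtain ⟨q, hq, s, hs, -, rfl⟩ := exists_add_dyck_of_mem_degreeLT (mem_degreeLT_totalDegree p)
  have hsv : s ∈ vanishingIdeal ℚ (QSVPoints n) := by
    have := sub_mem hp (shiftedIdeal_le n hq)
    rwa [add_sub_cancel_left] at this
  rw [eq_zero_of_mem_dyckSpan hs hsv, add_zero]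
  exact hq

theorem topComponent_eq {n d : ℕ} {p m : MvPolynomial (Fin n) ℚ} (hm : m.IsHomogeneous d)
    (hm0 : m ≠ 0) (h : p - m ∈ degreeLT n d) : topComponent p = m := by
  have hp : homogeneousComponent d p = m := by
    have := homogeneousComponent_eq_zero_of_mem_degreeLT h
    rw [map_sub, homogeneousComponent_eq_self hm] at this
    exact sub_eq_zero.mp this
  have hdeg : p.totalDegree = d := by
    apply le_antisymm
    · have h1 := add_mem (degreeLT_mono (Nat.le_succ d) h) (isHomogeneous_mem_degreeLT hm)
      rw [sub_add_cancel] at h1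
      exact Finset.sup_le fun s hs => Nat.le_of_lt_succ (mem_degreeLT.mp h1 s hs)
    · by_contra hlt
      exact hm0 (hp.symm.trans (homogeneousComponent_eq_zero _ _ (not_le.mp hlt)))
  rw [topComponent, hdeg, hp]

theorem topComponent_mem_qsymIdeal {n : ℕ} {f : MvPolynomial (Fin n) ℚ}
    (hf : f ∈ vanishingIdeal ℚ (QSVPoints n)) : topComponent f ∈ qsymIdeal n := by
  set d := f.totalDegree with hd
  obtain ⟨q, hq, s, hs, hqs⟩ := exists_add_dyck f
  obtain ⟨q', hq', hlow⟩ := exists_shiftedIdeal_sub_mem hq d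
  have hcomp := congrArg (homogeneousComponent d) hqs
  rw [map_add] at hcomp
  obtain ⟨j, hj, w, hw, hwd, hjw⟩ := exists_add_dyck_of_mem_degreeLT
    (add_mem hlow (sub_homogeneousComponent_mem_degreeLT (mem_degreeLT_totalDegree f)))
  rw [hcomp] at hjw
  have hsd := homogeneousComponent_mem_dyckSpan hs d
  have hv : homogeneousComponent d s + w ∈ vanishingIdeal ℚ (QSVPoints n) := by
    have : homogeneousComponent d s + w = f - q' - j := by linear_combination -hjw
    rw [this]
    exact sub_mem (sub_mem hf (shiftedIdeal_le n hq')) (shiftedIdeal_le n hj)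
  -- Since `w` has degree less than `d`, the vanishing of the sum kills the degree-`d` part of `s`,
  -- so the top component of `f` is that of `q`.
  have hzero := congrArg (homogeneousComponent d) (eq_zero_of_mem_dyckSpan (add_mem hsd hw) hv)
  rw [map_add, homogeneousComponent_eq_zero_of_mem_degreeLT hwd, map_zero, add_zero,
    homogeneousComponent_eq_self (homogeneousComponent_isHomogeneous d s)] at hzero
  rw [topComponent, ← hd, hcomp, hzero, add_zero]
  exact homogeneousComponent_mem_qsymIdeal hq d

theorem qsymIdeal_eq_topDegreeIdeal (n : ℕ) :
    qsymIdeal n = topDegreeIdeal (vanishingIdeal ℚ (QSVPoints n)) := by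
  apply le_antisymm
  · apply Ideal.span_mono
    rintro _ ⟨α, h0, hα, hlen, rfl⟩
    let c : Composition α.sum := ⟨α, fun {i} hi => hα i hi, rfl⟩
    exact ⟨vanishingPoly n c, vanishingPoly_mem_vanishingIdeal n c (sum_pos_of_ne_nil h0 hα),
      topComponent_eq (monomialQSymPoly_isHomogeneous n α) (monomialQSymPoly_ne_zero hα hlen)
        (vanishingPoly_sub_mem_degreeLT n c)⟩
  · apply Ideal.span_le.mpr
    rintro _ ⟨f, hf, rfl⟩
    exact topComponent_mem_qsymIdeal hf

end

theorem mainTheorem4 (n : ℕ) :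
    Ideal.span {p : MvPolynomial (Fin n) ℚ |
        ∃ (d : ℕ) (α : Composition d), 0 < d ∧ α.length ≤ n ∧ p = vanishingPoly n α}
      = MvPolynomial.vanishingIdeal ℚ (QSVPoints n) ∧
    Ideal.span (QSymPos n) = topDegreeIdeal (MvPolynomial.vanishingIdeal ℚ (QSVPoints n)) :=
  ⟨shiftedIdeal_eq n, (span_QSymPos n).trans (qsymIdeal_eq_topDegreeIdeal n)⟩
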